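/- Let $G=\mathbb R^2\ltimes\mathbb R^4$ be the six-dimensional, completely solvable Lie group with coordinates $(t,x,y_1,y_2,z_1,z_2)\in\mathbb R^6$ and product $$(t,x,y_1,y_2,z_1,z_2)*(t',x',y_1',y_2',z_1',z_2')=(t+t',\,x+x',\,y_1'e^{t}+xz_1'e^{t}+y_1,\,y_2'e^{-t}+xz_2'e^{-t}+y_2,\,z_1'e^{t}+z_1,\,z_2'e^{-t}+z_2).$$ Let $B\in SL(2,\mathbb Z)$ have distinct eigenvalues $e^{a_0},e^{-a_0}$ ($a_0\in\mathbb R\setminus\{0\}$), let $P\in GL(2,\mathbb R)$ satisfy $PBP^{-1}=\mathrm{diag}(e^{a_0},e^{-a_0})$, let $\Gamma\subset G$ be the lattice of all points with $t\in a_0\mathbb Z$, $x\in\mathbb Z$, $(y_1,y_2)^T\in P\mathbb Z^2$, $(z_1,z_2)^T\in P\mathbb Z^2$, and let $X=\Gamma\backslash G$, a compact $\mathbb T^4$-bundle over $\mathbb T^2$. Consider on $G$ the left-invariant coframe $e^1=dt$, $e^2=dx$, $e^3=e^{-t}dy_1-xe^{-t}dz_1$, $e^4=e^{t}dy_2-xe^{t}dz_2$,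 $e^5=e^{-t}dz_1$, $e^6=e^{t}dz_2$, with dual frame $e_1,\dots,e_6$. For $a,b,c\in\mathbb R$ with $a\neq0$, $c\neq0$, let $(J_{a,b,c},\omega_{a,b,c})$ be the almost-Kähler structure on $X$ induced by $$\omega_{a,b,c}=a\,e^{1}\wedge e^2+b\,e^{5}\wedge e^6+c\,(e^{3}\wedge e^6+e^{4}\wedge e^5),$$ $$Je_1=ae_2,\quad Je_2=-\tfrac1a e_1,\quad Je_3=ce_6,\quad Je_4=ce_5-be_3,\quad Je_5=-\tfrac1c e_4+be_6,\quad Je_6=-\tfrac1c e_3,$$ with Hermitian metric $g(\cdot,\cdot)=\omega_{a,b,c}(\cdot,J_{a,b,c}\,\cdot)$. Let $A^{p,q}(X)$ be the space of smooth complex-valued forms of type $(p,q)$ on $X$, let $\bar\partial:A^{p,q}(X)\to A^{p,q+1}(X)$ be the component of type $(p,q+1)$ of the exterior derivative, let $\bar\partial^*$ be its formal adjoint with respect to the $L^2$ product given by $g$, let $\Delta_{\bar\partial}=\bar\partial\bar\partial^*+\bar\partial^*\bar\partial$, and let $h^{p,q}_{\bar\partial}=\dim_{\mathbb C}\ker\bigl(\Delta_{\bar\partial}|_{A^{p,q}(X)}\bigr)$.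 Then, for all such $B,P,a_0,a,b,c$: * $h^{1,0}_{\bar\partial}=1$; * $h^{2,0}_{\bar\partial}=0$ if $c\notin4\pi\mathbb Z$, and $h^{2,0}_{\bar\partial}=2$ if $c\in4\pi\mathbb Z$; * $h^{3,0}_{\bar\partial}=1$. -/

import Mathlib

noncomputable section

namespace Solvmanifold

open scoped ContDiff
open MeasureTheory

/-- The coordinate space of `G`; the coordinates `0, …, 5` are `t, x, y₁, y₂, z₁, z₂`. It is also
the tangent space at every point. -/
abbrev E : Type := Fin 6 → ℝ

/-! ### The solvable Lie group `G` -/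

/-- The Lie group `G = ℝ² ⋉ ℝ⁴`, in the global coordinates `(t, x, y₁, y₂, z₁, z₂)`. -/
def G : Type := E

/-- The group law of `G` in coordinates. -/
def gmul (g h : E) : E :=
  ![g 0 + h 0, g 1 + h 1,
    h 2 * Real.exp (g 0) + g 1 * h 4 * Real.exp (g 0) + g 2,
    h 3 * Real.exp (-g 0) + g 1 * h 5 * Real.exp (-g 0) + g 3,
    h 4 * Real.exp (g 0) + g 4,
    h 5 * Real.exp (-g 0) + g 5]

/-- Inversion of `G` in coordinates. -/
def ginv (g : E) : E :=
  ![-g 0, -g 1,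
    (g 1 * g 4 - g 2) * Real.exp (-g 0),
    (g 1 * g 5 - g 3) * Real.exp (g 0),
    -g 4 * Real.exp (-g 0),
    -g 5 * Real.exp (g 0)]

instance : Group G where
  mul := gmul
  one := (0 : E)
  inv := ginv
  mul_assoc f g h := by
    change gmul (gmul f g) h = gmul f (gmul g h)
    ext i
    fin_cases i <;> simp [gmul, Real.exp_add] <;> ring
  one_mul g := by
    change gmul 0 g = g
    ext i
    fin_cases i <;> simp [gmul]
  mul_one g := by
    change gmul g 0 = g
    ext i
    fin_cases i <;> simp [gmul]
  inv_mul_cancel g := by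
    change gmul (ginv g) g = 0
    ext i
    fin_cases i <;> simp [gmul, ginv] <;> ring

/-- The coordinates of an element of `G`. -/
def G.coords (g : G) : E := g

/-- The left translation `x ↦ γ * x` of `G`, in coordinates. -/
def leftTrans (γ : G) : E → E := gmul γ.coords

/-- The realization of `G` as a group of real matrices. -/
def toMatrix (g : E) : Matrix (Fin 6) (Fin 6) ℝ :=
  !![Real.exp (g 0), 0, g 1 * Real.exp (g 0), 0, 0, g 2;
     0, Real.exp (-g 0), 0, g 1 * Real.exp (-g 0), 0, g 3;
     0, 0, Real.exp (g 0), 0, 0, g 4;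
     0, 0, 0, Real.exp (-g 0), 0, g 5;
     0, 0, 0, 0, 1, g 0;
     0, 0, 0, 0, 0, 1]

theorem toMatrix_gmul (g h : E) : toMatrix (gmul g h) = toMatrix g * toMatrix h := by
  ext i j
  fin_cases i <;> fin_cases j <;>
    simp [toMatrix, gmul, Matrix.mul_apply, Fin.sum_univ_succ, Real.exp_add] <;> ring

/-! ### The lattice -/

/-- The data defining the lattice: `B ∈ SL(2, ℤ)` with distinct eigenvalues `e^{a₀}, e^{-a₀}`,
and a real invertible matrix `P` that diagonalizes it. -/
structure LatticeData where
  a₀ : ℝ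
  B : Matrix.SpecialLinearGroup (Fin 2) ℤ
  P : GL (Fin 2) ℝ
  a₀_ne_zero : a₀ ≠ 0
  conj_eq : (P : Matrix (Fin 2) (Fin 2) ℝ) * (B : Matrix (Fin 2) (Fin 2) ℤ).map (fun z => (z : ℝ))
    * ((P⁻¹ : GL (Fin 2) ℝ) : Matrix (Fin 2) (Fin 2) ℝ)
      = !![Real.exp a₀, 0; 0, Real.exp (-a₀)]

/-- The vector `P m` of the planar lattice `P ℤ²`. -/
def LatticeData.vec (D : LatticeData) (m : Fin 2 → ℤ) : Fin 2 → ℝ :=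
  (D.P : Matrix (Fin 2) (Fin 2) ℝ).mulVec (fun i => (m i : ℝ))

theorem LatticeData.P_mul_B (D : LatticeData) :
    (D.P : Matrix (Fin 2) (Fin 2) ℝ) * (D.B : Matrix (Fin 2) (Fin 2) ℤ).map (fun z => (z : ℝ))
      = !![Real.exp D.a₀, 0; 0, Real.exp (-D.a₀)] * (D.P : Matrix (Fin 2) (Fin 2) ℝ) := by
  rw [← D.conj_eq, Matrix.mul_assoc, ← Units.val_mul, inv_mul_cancel, Units.val_one,
    Matrix.mul_one]

theorem LatticeData.vec_mulVec (D : LatticeData) (m : Fin 2 → ℤ) :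
    D.vec ((D.B : Matrix (Fin 2) (Fin 2) ℤ).mulVec m)
      = ![Real.exp D.a₀ * D.vec m 0, Real.exp (-D.a₀) * D.vec m 1] := by
  have h : (fun i => (((D.B : Matrix (Fin 2) (Fin 2) ℤ).mulVec m i : ℤ) : ℝ))
      = ((D.B : Matrix (Fin 2) (Fin 2) ℤ).map (fun z => (z : ℝ))).mulVec (fun i => (m i : ℝ)) := by
    ext i
    simp [Matrix.mulVec, dotProduct]
  unfold LatticeData.vec
  rw [h, Matrix.mulVec_mulVec, D.P_mul_B, ← Matrix.mulVec_mulVec]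
  ext i
  fin_cases i <;> simp [Matrix.mulVec, dotProduct, Fin.sum_univ_succ]

theorem LatticeData.exists_vec_zpow (D : LatticeData) (k : ℤ) (m : Fin 2 → ℤ) :
    ∃ m' : Fin 2 → ℤ, D.vec m'
      = ![Real.exp (D.a₀ * k) * D.vec m 0, Real.exp (-(D.a₀ * k)) * D.vec m 1] := by
  induction k using Int.induction_on generalizing m with
  | zero =>
    refine ⟨m, ?_⟩
    ext i
    fin_cases i <;> simp
  | succ k ih =>
    obtain ⟨m', h⟩ := ih m
    refine ⟨_, (D.vec_mulVec m').trans ?_⟩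
    rw [h]
    ext i
    fin_cases i <;> simp [mul_add, Real.exp_add] <;> ring
  | pred k ih =>
    obtain ⟨m', h⟩ := ih m
    refine ⟨((D.B⁻¹ : Matrix.SpecialLinearGroup (Fin 2) ℤ) : Matrix (Fin 2) (Fin 2) ℤ).mulVec m',
      ?_⟩
    have h2 := D.vec_mulVec
      (((D.B⁻¹ : Matrix.SpecialLinearGroup (Fin 2) ℤ) : Matrix (Fin 2) (Fin 2) ℤ).mulVec m')
    rw [Matrix.mulVec_mulVec, ← Matrix.SpecialLinearGroup.coe_mul, mul_inv_cancel,
      Matrix.SpecialLinearGroup.coe_one, Matrix.one_mulVec, h] at h2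
    have h0 := congrFun h2 0
    have h1 := congrFun h2 1
    simp only [Matrix.cons_val_zero, Matrix.cons_val_one] at h0 h1
    ext i
    fin_cases i
    · simp only [Fin.zero_eta, Matrix.cons_val_zero]
      have : Real.exp (D.a₀ * ((-(k : ℤ) - 1 : ℤ) : ℝ))
          = Real.exp (-D.a₀) * Real.exp (D.a₀ * ((-(k : ℤ) : ℤ) : ℝ)) := by
        rw [← Real.exp_add]; congr 1; push_cast; ring
      rw [this, mul_assoc, h0, ← mul_assoc, ← Real.exp_add]
      simp
    · simp only [Fin.mk_one, Matrix.cons_val_one, Matrix.cons_val_zero]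
      have : Real.exp (-(D.a₀ * ((-(k : ℤ) - 1 : ℤ) : ℝ)))
          = Real.exp (D.a₀) * Real.exp (-(D.a₀ * ((-(k : ℤ) : ℤ) : ℝ))) := by
        rw [← Real.exp_add]; congr 1; push_cast; ring
      rw [this, mul_assoc, h1, ← mul_assoc, ← Real.exp_add]
      simp

theorem LatticeData.vec_add (D : LatticeData) (m n : Fin 2 → ℤ) :
    D.vec (m + n) = D.vec m + D.vec n := by
  unfold LatticeData.vec
  rw [← Matrix.mulVec_add]
  congr 1
  ext i
  simp

theorem LatticeData.vec_smul (D : LatticeData) (u : ℤ) (n : Fin 2 → ℤ) :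
    D.vec (u • n) = (u : ℝ) • D.vec n := by
  unfold LatticeData.vec
  rw [← Matrix.mulVec_smul]
  congr 1
  ext i
  simp

/-- The points of `Γ = (a₀ℤ × ℤ) ⋉ (Pℤ² × Pℤ²)`. -/
def LatticeData.IsLatticePoint (D : LatticeData) (g : E) : Prop :=
  ∃ (k u : ℤ) (m n : Fin 2 → ℤ), g 0 = D.a₀ * k ∧ g 1 = u ∧
    ![g 2, g 3] = D.vec m ∧ ![g 4, g 5] = D.vec n

/-- The lattice `Γ` of `G`. -/
def LatticeData.lattice (D : LatticeData) : Subgroup G where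
  carrier := {g | D.IsLatticePoint g}
  one_mem' := by
    refine ⟨0, 0, 0, 0, ?_, ?_, ?_, ?_⟩
    · change (0 : E) 0 = _; simp
    · change (0 : E) 1 = _; simp
    · change ![(0 : E) 2, (0 : E) 3] = _
      ext i; fin_cases i <;> simp [LatticeData.vec, Matrix.mulVec, dotProduct]
    · change ![(0 : E) 4, (0 : E) 5] = _
      ext i; fin_cases i <;> simp [LatticeData.vec, Matrix.mulVec, dotProduct]
  mul_mem' := by
    rintro g h ⟨k, u, m, n, h0, h1, hm, hn⟩ ⟨k', u', m', n', h0', h1', hm', hn'⟩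
    obtain ⟨p, hp⟩ := D.exists_vec_zpow k m'
    obtain ⟨q, hq⟩ := D.exists_vec_zpow k n'
    change D.IsLatticePoint (gmul g h)
    refine ⟨k + k', u + u', p + u • q + m, q + n, ?_, ?_, ?_, ?_⟩
    · simp [gmul, h0, h0', mul_add]
    · simp [gmul, h1, h1']
    · rw [D.vec_add, D.vec_add, D.vec_smul, hp, hq, ← hm, ← hm', ← hn']
      ext i
      fin_cases i <;> simp [gmul, h0, h1] <;> ring
    · rw [D.vec_add, hq, ← hn, ← hn']
      ext i
      fin_cases i <;> simp [gmul, h0] <;> ring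
  inv_mem' := by
    rintro g ⟨k, u, m, n, h0, h1, hm, hn⟩
    obtain ⟨p, hp⟩ := D.exists_vec_zpow (-k) m
    obtain ⟨q, hq⟩ := D.exists_vec_zpow (-k) n
    change D.IsLatticePoint (ginv g)
    refine ⟨-k, -u, u • q + (-1 : ℤ) • p, (-1 : ℤ) • q, ?_, ?_, ?_, ?_⟩
    · simp [ginv, h0]
    · simp [ginv, h1]
    · rw [D.vec_add, D.vec_smul, D.vec_smul, hp, hq, ← hm, ← hn]
      ext i
      fin_cases i <;> simp [ginv, h0, h1] <;> ring
    · rw [D.vec_smul, hq, ← hn]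
      ext i
      fin_cases i <;> simp [ginv, h0] <;> ring

/-- A fundamental domain for the left translations by `Γ`. -/
def LatticeData.fundDomain (D : LatticeData) : Set E :=
  {g | ∃ s : Fin 6 → ℝ, (∀ i, s i ∈ Set.Ico (0 : ℝ) 1) ∧ g 0 = D.a₀ * s 0 ∧ g 1 = s 1 ∧
    ![g 2, g 3] = (D.P : Matrix (Fin 2) (Fin 2) ℝ).mulVec ![s 2, s 3] ∧
    ![g 4, g 5] = (D.P : Matrix (Fin 2) (Fin 2) ℝ).mulVec ![s 4, s 5]}

theorem LatticeData.existsUnique_planar (D : LatticeData) (y : Fin 2 → ℝ) :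
    ∃! m : Fin 2 → ℤ, ∃ s : Fin 2 → ℝ, (∀ i, s i ∈ Set.Ico (0 : ℝ) 1) ∧
      D.vec m + y = (D.P : Matrix (Fin 2) (Fin 2) ℝ).mulVec s := by
  have hinv : ((D.P⁻¹ : GL (Fin 2) ℝ) : Matrix (Fin 2) (Fin 2) ℝ)
      * (D.P : Matrix (Fin 2) (Fin 2) ℝ) = 1 := by
    rw [← Units.val_mul, inv_mul_cancel, Units.val_one]
  have hinv' : (D.P : Matrix (Fin 2) (Fin 2) ℝ)
      * ((D.P⁻¹ : GL (Fin 2) ℝ) : Matrix (Fin 2) (Fin 2) ℝ) = 1 := by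
    rw [← Units.val_mul, mul_inv_cancel, Units.val_one]
  set w : Fin 2 → ℝ := ((D.P⁻¹ : GL (Fin 2) ℝ) : Matrix (Fin 2) (Fin 2) ℝ).mulVec y with hw
  have hy : y = (D.P : Matrix (Fin 2) (Fin 2) ℝ).mulVec w := by
    rw [hw, Matrix.mulVec_mulVec, hinv', Matrix.one_mulVec]
  refine ⟨fun i => -⌊w i⌋, ⟨fun i => Int.fract (w i), ?_, ?_⟩, ?_⟩
  · exact fun i => ⟨Int.fract_nonneg _, Int.fract_lt_one _⟩
  · rw [hy]
    unfold LatticeData.vec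
    rw [← Matrix.mulVec_add]
    congr 1
    ext i
    simp only [Pi.add_apply, Int.cast_neg, Int.fract]
    ring
  · rintro m ⟨s, hs, h⟩
    rw [hy] at h
    unfold LatticeData.vec at h
    rw [← Matrix.mulVec_add] at h
    have h2 := congrArg
      (((D.P⁻¹ : GL (Fin 2) ℝ) : Matrix (Fin 2) (Fin 2) ℝ).mulVec) h
    rw [Matrix.mulVec_mulVec, Matrix.mulVec_mulVec, hinv, Matrix.one_mulVec,
      Matrix.one_mulVec] at h2
    ext i
    have h3 := congrFun h2 i
    simp only [Pi.add_apply] at h3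
    have h4 : ⌊w i⌋ = -m i := by
      rw [Int.floor_eq_iff]
      push_cast
      constructor
      · linarith [(hs i).1]
      · linarith [(hs i).2]
    simp [h4]

/-- Every `Γ`-orbit meets `fundDomain` in exactly one point, for exactly one element of `Γ`; so an
integral over `fundDomain` of a `Γ`-invariant density is the integral over `X`. -/
theorem LatticeData.existsUnique_mem_fundDomain (D : LatticeData) (g : G) :
    ∃! γ : G, γ ∈ D.lattice ∧ (γ * g : G) ∈ D.fundDomain := by
  obtain ⟨a₀, ha₀⟩ : ∃ a₀, a₀ = D.a₀ := ⟨_, rfl⟩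
  have hne : a₀ ≠ 0 := ha₀ ▸ D.a₀_ne_zero
  obtain ⟨x, hx⟩ : ∃ x : E, x = g := ⟨g, rfl⟩
  set k : ℤ := -⌊x 0 / a₀⌋ with hk
  set u : ℤ := -⌊x 1⌋ with hu
  obtain ⟨m, ⟨s, hs, hm⟩, hm'⟩ := D.existsUnique_planar
    ![x 2 * Real.exp (a₀ * k) + u * x 4 * Real.exp (a₀ * k),
      x 3 * Real.exp (-(a₀ * k)) + u * x 5 * Real.exp (-(a₀ * k))]
  obtain ⟨n, ⟨r, hr, hn⟩, hn'⟩ := D.existsUnique_planar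
    ![x 4 * Real.exp (a₀ * k), x 5 * Real.exp (-(a₀ * k))]
  have eta : ∀ v : Fin 2 → ℝ, ![v 0, v 1] = v := fun v => by
    ext i; fin_cases i <;> rfl
  refine ⟨(![a₀ * k, u, D.vec m 0, D.vec m 1, D.vec n 0, D.vec n 1] : E), ⟨?_, ?_⟩, ?_⟩
  · exact ⟨k, u, m, n, by simp [ha₀], by simp, by ext i; fin_cases i <;> simp,
      by ext i; fin_cases i <;> simp⟩
  · change gmul _ g ∈ D.fundDomain
    rw [← hx]
    refine ⟨![Int.fract (x 0 / a₀), Int.fract (x 1), s 0, s 1, r 0, r 1], ?_, ?_, ?_, ?_, ?_⟩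
    · intro i
      fin_cases i
      · exact ⟨Int.fract_nonneg _, Int.fract_lt_one _⟩
      · exact ⟨Int.fract_nonneg _, Int.fract_lt_one _⟩
      · exact hs 0
      · exact hs 1
      · exact hr 0
      · exact hr 1
    · simp only [gmul, Matrix.cons_val_zero, hk, ← ha₀, Int.fract]
      push_cast
      field_simp
      ring
    · simp only [gmul, Matrix.cons_val_one, Matrix.cons_val_zero, hu, Int.fract]
      push_cast
      ring
    · have : ![(![Int.fract (x 0 / a₀), Int.fract (x 1), s 0, s 1, r 0, r 1] : E) 2,
          (![Int.fract (x 0 / a₀), Int.fract (x 1), s 0, s 1, r 0, r 1] : E) 3] = s := eta s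
      rw [this, ← hm]
      ext i
      fin_cases i <;> simp [gmul] <;> ring
    · have : ![(![Int.fract (x 0 / a₀), Int.fract (x 1), s 0, s 1, r 0, r 1] : E) 4,
          (![Int.fract (x 0 / a₀), Int.fract (x 1), s 0, s 1, r 0, r 1] : E) 5] = r := eta r
      rw [this, ← hn]
      ext i
      fin_cases i <;> simp [gmul] <;> ring
  · rintro γ ⟨⟨k₁, u₁, m₁, n₁, h0, h1, h2, h3⟩, ⟨w, hw, w0, w1, w2, w3⟩⟩
    obtain ⟨y, hy⟩ : ∃ y : E, y = γ := ⟨γ, rfl⟩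
    have hmul : (γ * g : G) = gmul y x := by rw [hy, hx]; rfl
    rw [hmul] at w0 w1 w2 w3
    rw [← hy] at h0 h1 h2 h3 ⊢
    have hk₁ : k₁ = k := by
      have : ⌊x 0 / a₀⌋ = -k₁ := by
        have e : x 0 / a₀ = w 0 - k₁ := by
          simp only [gmul, Matrix.cons_val_zero] at w0
          rw [h0, ← ha₀] at w0
          field_simp
          linarith
        rw [Int.floor_eq_iff]
        push_cast
        constructor <;> linarith [(hw 0).1, (hw 0).2]
      rw [hk, this, neg_neg]
    have hu₁ : u₁ = u := by
      have : ⌊x 1⌋ = -u₁ := by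
        simp only [gmul, Matrix.cons_val_zero, Matrix.cons_val_one] at w1
        rw [Int.floor_eq_iff]
        push_cast
        constructor <;> linarith [(hw 1).1, (hw 1).2]
      rw [hu, this, neg_neg]
    subst hk₁ hu₁
    have hm₁ : m₁ = m := by
      apply hm'
      refine ⟨![w 2, w 3], ?_, ?_⟩
      · intro i
        fin_cases i
        · exact hw 2
        · exact hw 3
      · rw [← w2, ← h2]
        ext i
        fin_cases i <;> simp [gmul, h0, h1, ha₀] <;> ring
    have hn₁ : n₁ = n := by
      apply hn'
      refine ⟨![w 4, w 5], ?_, ?_⟩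
      · intro i
        fin_cases i
        · exact hw 4
        · exact hw 5
      · rw [← w3, ← h3]
        ext i
        fin_cases i <;> simp [gmul, h0, ha₀] <;> ring
    subst hm₁ hn₁
    rw [← h2, ← h3]
    refine @funext (Fin 6) (fun _ => ℝ) y _ fun i => ?_
    fin_cases i <;> simp [h0, h1, ha₀]

/-! ### The left-invariant frame and the almost-Kähler structure -/

/-- The left-invariant coframe `e¹, …, e⁶` at the point `x` of `G`. -/
def coframe (x : E) : Fin 6 → (E →L[ℝ] ℝ) :=
  let d : Fin 6 → (E →L[ℝ] ℝ) := fun i => ContinuousLinearMap.proj i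
  ![d 0, d 1,
    Real.exp (-x 0) • d 2 - (x 1 * Real.exp (-x 0)) • d 4,
    Real.exp (x 0) • d 3 - (x 1 * Real.exp (x 0)) • d 5,
    Real.exp (-x 0) • d 4,
    Real.exp (x 0) • d 5]

/-- The dual left-invariant frame `e₁, …, e₆` at the point `x` of `G`. -/
def frame (x : E) : Fin 6 → E :=
  ![![1, 0, 0, 0, 0, 0],
    ![0, 1, 0, 0, 0, 0],
    ![0, 0, Real.exp (x 0), 0, 0, 0],
    ![0, 0, 0, Real.exp (-x 0), 0, 0],
    ![0, 0, x 1 * Real.exp (x 0), 0, Real.exp (x 0), 0],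
    ![0, 0, 0, x 1 * Real.exp (-x 0), 0, Real.exp (-x 0)]]

theorem coframe_frame (x : E) (i j : Fin 6) :
    coframe x i (frame x j) = if i = j then 1 else 0 := by
  fin_cases i <;> fin_cases j <;>
    simp [coframe, frame, Real.exp_neg] <;> field_simp <;> simp

/-- The almost-complex structure `J_{a,b,c}` at `x`: `J e₁ = a e₂`, `J e₂ = -a⁻¹ e₁`, `J e₃ = c e₆`,
`J e₄ = c e₅ - b e₃`, `J e₅ = -c⁻¹ e₄ + b e₆`, `J e₆ = -c⁻¹ e₃`. -/
def J (a b c : ℝ) (x : E) : E →L[ℝ] E :=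
  ∑ i, (coframe x i).smulRight
    ((![a • frame x 1,
      -(1 / a) • frame x 0,
      c • frame x 5,
      c • frame x 4 - b • frame x 2,
      -(1 / c) • frame x 3 + b • frame x 5,
      -(1 / c) • frame x 2] : Fin 6 → E) i)

/-- `e^{ij} = eⁱ ∧ eʲ` at `x`. -/
def wedge₂ (x : E) (i j : Fin 6) (v w : E) : ℝ :=
  coframe x i v * coframe x j w - coframe x j v * coframe x i w

/-- The symplectic form `ω_{a,b,c} = a e¹² + b e⁵⁶ + c (e³⁶ + e⁴⁵)`. -/
def omega (a b c : ℝ) (x v w : E) : ℝ :=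
  a * wedge₂ x 0 1 v w + b * wedge₂ x 4 5 v w + c * (wedge₂ x 2 5 v w + wedge₂ x 3 4 v w)

/-- The Riemannian metric `g(v, w) = ω(v, J w)`. -/
def metric (a b c : ℝ) (x v w : E) : ℝ := omega a b c x v (J a b c x w)

theorem J_frame (a b c : ℝ) (x : E) (j : Fin 6) :
    J a b c x (frame x j) = (![a • frame x 1,
      -(1 / a) • frame x 0,
      c • frame x 5,
      c • frame x 4 - b • frame x 2,
      -(1 / c) • frame x 3 + b • frame x 5,
      -(1 / c) • frame x 2] : Fin 6 → E) j := by
  simp only [J, sum_apply, ContinuousLinearMap.smulRight_apply, coframe_frame,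
    ite_smul, one_smul, zero_smul, Finset.sum_ite_eq', Finset.mem_univ, if_true]

theorem sum_coframe_smul_frame (x v : E) : ∑ i, coframe x i v • frame x i = v := by
  ext i
  fin_cases i <;>
    simp [Fin.sum_univ_succ, coframe, frame, Real.exp_neg] <;> field_simp <;> ring

theorem J_J {a b c : ℝ} (ha : a ≠ 0) (hc : c ≠ 0) (x v : E) :
    J a b c x (J a b c x v) = -v := by
  have key : ∀ j, J a b c x (J a b c x (frame x j)) = -frame x j := by
    intro j
    rw [J_frame]
    fin_cases j <;> simp [J_frame, smul_smul, smul_sub, ha, hc]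
    all_goals abel_nf
    all_goals simp [mul_comm]
  conv_lhs => rw [← sum_coframe_smul_frame x v]
  conv_rhs => rw [← sum_coframe_smul_frame x v]
  simp only [map_sum, map_smul, key, smul_neg, Finset.sum_neg_distrib]

/-- A `g`-orthonormal left-invariant frame at `x`. -/
def orthoFrame (a b c : ℝ) (x : E) : Fin 6 → E :=
  ![(1 / a) • frame x 0, frame x 1, (1 / c) • frame x 2, (1 / c) • frame x 3,
    frame x 4 - (b / c) • frame x 2, frame x 5]

theorem metric_orthoFrame {a b c : ℝ} (ha : a ≠ 0) (hc : c ≠ 0) (x : E) (i j : Fin 6) :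
    metric a b c x (orthoFrame a b c x i) (orthoFrame a b c x j) = if i = j then 1 else 0 := by
  fin_cases i <;> fin_cases j <;>
    simp [metric, omega, wedge₂, orthoFrame, J_frame, coframe_frame, ha, hc]
  all_goals field_simp
  all_goals ring

/-! ### Differential forms on `X = Γ \ G` and their bigrading -/

/-- Complex-valued `k`-forms on `G` (no regularity required yet). -/
abbrev Form (k : ℕ) : Type := E → E [⋀^Fin k]→L[ℝ] ℂ

/-- For a complex structure `J` on the vector space `E`, the space `Λ^{p,q}` of complex-valued
`k`-covectors: the span of the `φ¹ ∧ ⋯ ∧ φᵏ` with `φ¹, …, φᵖ` of type `(1,0)` and the other `q`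
factors of type `(0,1)`. It is zero if `p + q ≠ k`. -/
def bigraded (J : E →L[ℝ] E) (k p q : ℕ) : Submodule ℂ (E [⋀^Fin k]→L[ℝ] ℂ) :=
  Submodule.span ℂ {α | p + q = k ∧ ∃ φ : Fin k → (E →L[ℝ] ℂ),
    (∀ i : Fin k, (i : ℕ) < p → ∀ v, φ i (J v) = Complex.I * φ i v) ∧
    (∀ i : Fin k, p ≤ (i : ℕ) → ∀ v, φ i (J v) = -Complex.I * φ i v) ∧
    ∀ v, α v = Matrix.det (Matrix.of fun i j => φ i (v j))}

/-- `A^{p,q}(X)`: the smooth `Γ`-invariant complex-valued forms on `G` of type `(p,q)` for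
`J_{a,b,c}`. Pull-back along the covering `G → X = Γ \ G` identifies forms on `X` with these. -/
def forms (D : LatticeData) (a b c : ℝ) (p q : ℕ) : Submodule ℂ (Form (p + q)) where
  carrier := {ψ | ContDiff ℝ ∞ ψ ∧
    (∀ γ ∈ D.lattice, ∀ x : E,
      (ψ (leftTrans γ x)).compContinuousLinearMap (fderiv ℝ (leftTrans γ) x) = ψ x) ∧
    ∀ x, ψ x ∈ bigraded (J a b c x) (p + q) p q}
  zero_mem' := ⟨contDiff_const, fun _ _ _ => by ext; simp, fun _ => Submodule.zero_mem _⟩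
  add_mem' := by
    rintro α β ⟨h1, h2, h3⟩ ⟨h1', h2', h3'⟩
    refine ⟨h1.add h1', fun γ hγ x => ?_, fun x => Submodule.add_mem _ (h3 x) (h3' x)⟩
    exact congrArg₂ (· + ·) (h2 γ hγ x) (h2' γ hγ x)
  smul_mem' := by
    rintro r α ⟨h1, h2, h3⟩
    refine ⟨h1.const_smul r, fun γ hγ x => ?_, fun x => Submodule.smul_mem _ _ (h3 x)⟩
    exact congrArg (r • ·) (h2 γ hγ x)

/-- The projection of `k`-covectors, `k = p + q`, onto the component of type `(p,q)`. The rotation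
`cos θ + sin θ J` acts on the component of type `(r,s)` by `e^{i(r-s)θ}`, so that the average below
over `θ = πj/(k+1)`, `0 ≤ j ≤ k`, singles out the type `(p,q)`; see `typeProj_of_mem`
and `typeProj_of_mem_ne`. -/
def typeProj (J : E →L[ℝ] E) {k : ℕ} (p q : ℕ) (α : E [⋀^Fin k]→L[ℝ] ℂ) : E [⋀^Fin k]→L[ℝ] ℂ :=
  (1 / ((k : ℂ) + 1)) • ∑ j ∈ Finset.range (k + 1),
    Complex.exp (-(((p : ℂ) - q) * (Real.pi * j / (k + 1) : ℝ) * Complex.I)) •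
      α.compContinuousLinearMap
        (Real.cos (Real.pi * j / (k + 1)) • ContinuousLinearMap.id ℝ E
          + Real.sin (Real.pi * j / (k + 1)) • J)

theorem typeProj_add (J : E →L[ℝ] E) {k : ℕ} (p q : ℕ) (α β : E [⋀^Fin k]→L[ℝ] ℂ) :
    typeProj J p q (α + β) = typeProj J p q α + typeProj J p q β := by
  ext v
  simp only [typeProj, ContinuousAlternatingMap.smul_apply, ContinuousAlternatingMap.sum_apply,
    ContinuousAlternatingMap.add_apply, ContinuousAlternatingMap.compContinuousLinearMap_apply,
    smul_eq_mul, mul_add, Finset.sum_add_distrib]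

theorem typeProj_smul (J : E →L[ℝ] E) {k : ℕ} (p q : ℕ) (r : ℂ) (α : E [⋀^Fin k]→L[ℝ] ℂ) :
    typeProj J p q (r • α) = r • typeProj J p q α := by
  ext v
  simp only [typeProj, ContinuousAlternatingMap.smul_apply, ContinuousAlternatingMap.sum_apply,
    ContinuousAlternatingMap.compContinuousLinearMap_apply, smul_eq_mul, Finset.mul_sum]
  refine Finset.sum_congr rfl fun j _ => ?_
  ring

theorem rotation_apply {J : E →L[ℝ] E} {k r s : ℕ} {α : E [⋀^Fin k]→L[ℝ] ℂ}
    (hα : α ∈ bigraded J k r s) (θ : ℝ) :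
    α.compContinuousLinearMap (Real.cos θ • ContinuousLinearMap.id ℝ E + Real.sin θ • J)
      = Complex.exp (((r : ℂ) - s) * θ * Complex.I) • α := by
  induction hα using Submodule.span_induction with
  | mem α h =>
    obtain ⟨hk, φ, h10, h01, hdet⟩ := h
    ext v
    rw [ContinuousAlternatingMap.compContinuousLinearMap_apply, ContinuousAlternatingMap.smul_apply,
      hdet, hdet]
    have hrow : (Matrix.of fun i j => φ i (((Real.cos θ • ContinuousLinearMap.id ℝ E
        + Real.sin θ • J) ∘ v) j)) = Matrix.of fun (i j : Fin k) =>
          (if (i : ℕ) < r then Complex.exp (θ * Complex.I) else Complex.exp (-(θ * Complex.I)))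
            * (Matrix.of fun (i j : Fin k) => φ i (v j)) i j := by
      ext i j
      simp only [Matrix.of_apply, Function.comp_apply, add_apply,
        smul_apply, ContinuousLinearMap.id_apply, map_add, map_smul,
        Complex.real_smul, Complex.ofReal_cos, Complex.ofReal_sin]
      split_ifs with h
      · rw [h10 i h, Complex.exp_mul_I]; ring
      · rw [h01 i (not_lt.mp h), ← neg_mul, Complex.exp_mul_I, Complex.cos_neg, Complex.sin_neg]
        ring
    rw [hrow, Matrix.det_mul_column, smul_eq_mul]
    congr 1
    subst hk
    rw [Fin.prod_univ_add]
    simp only [Fin.val_castAdd, Fin.is_lt, if_true, Fin.val_natAdd, Finset.prod_const,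
      Finset.card_univ, Fintype.card_fin, ← Complex.exp_nat_mul,
      show ∀ x : ℕ, ¬ (r + x < r) from fun x => by omega, if_false, ← Complex.exp_add]
    congr 1
    ring
  | zero => ext; simp
  | add x y _ _ hx hy => rw [smul_add, ← hx, ← hy]; rfl
  | smul t x _ hx => rw [smul_comm, ← hx]; rfl

/-- `typeProj` is the identity on `Λ^{p,q}`. -/
theorem typeProj_of_mem {J : E →L[ℝ] E} {k p q : ℕ} {α : E [⋀^Fin k]→L[ℝ] ℂ}
    (hα : α ∈ bigraded J k p q) : typeProj J p q α = α := by
  unfold typeProj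
  simp only [rotation_apply hα, smul_smul, ← Complex.exp_add]
  simp only [neg_add_cancel, Complex.exp_zero, one_smul, Finset.sum_const, Finset.card_range]
  rw [← Nat.cast_smul_eq_nsmul ℂ, smul_smul]
  have : ((k : ℂ) + 1) ≠ 0 := Nat.cast_add_one_ne_zero k
  push_cast
  rw [one_div, inv_mul_cancel₀ this, one_smul]

/-- `typeProj` annihilates the other summands of the bigrading. -/
theorem typeProj_of_mem_ne {J : E →L[ℝ] E} {k p q r s : ℕ} {α : E [⋀^Fin k]→L[ℝ] ℂ}
    (hpq : p + q = k) (hrs : r + s = k) (hne : r ≠ p)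
    (hα : α ∈ bigraded J k r s) : typeProj J p q α = 0 := by
  unfold typeProj
  simp only [rotation_apply hα, smul_smul, ← Complex.exp_add]
  rw [← Finset.sum_smul]
  have hk : ((k : ℂ) + 1) ≠ 0 := Nat.cast_add_one_ne_zero k
  set z : ℂ := Complex.exp (2 * Real.pi * Complex.I * (((r : ℂ) - p) / (k + 1))) with hz
  have hterm : ∀ j ∈ Finset.range (k + 1),
      Complex.exp (-(((p : ℂ) - q) * (Real.pi * j / (k + 1) : ℝ) * Complex.I)
        + ((r : ℂ) - s) * (Real.pi * j / (k + 1) : ℝ) * Complex.I) = z ^ j := by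
    intro j _
    rw [hz, ← Complex.exp_nat_mul]
    congr 1
    have e1 : (q : ℂ) = k - p := by rw [← hpq]; push_cast; ring
    have e2 : (s : ℂ) = k - r := by rw [← hrs]; push_cast; ring
    rw [e1, e2]
    push_cast
    field_simp
    ring
  rw [Finset.sum_congr rfl hterm]
  have hz1 : z ≠ 1 := by
    intro h
    rw [hz, Complex.exp_eq_one_iff] at h
    obtain ⟨n, hn⟩ := h
    have hpi : (2 * Real.pi * Complex.I : ℂ) ≠ 0 := Complex.two_pi_I_ne_zero
    have h1 : (((r : ℂ) - p) / (k + 1)) = n := by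
      apply mul_left_cancel₀ hpi
      rw [hn]; ring
    rw [div_eq_iff hk] at h1
    have h2 : ((r : ℤ) - p) = n * (k + 1) := by exact_mod_cast h1
    have h3 : |((r : ℤ) - p)| < k + 1 := by
      rw [abs_lt]; omega
    rw [h2, abs_mul] at h3
    have h4 : |(k : ℤ) + 1| = k + 1 := abs_of_nonneg (by omega)
    rw [h4] at h3
    have h5 : |n| < 1 := by
      by_contra hcon
      push Not at hcon
      nlinarith
    have h6 : n = 0 := Int.abs_lt_one_iff.mp h5
    rw [h6] at h2
    omega
  have hzk : z ^ (k + 1) = 1 := by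
    rw [hz, ← Complex.exp_nat_mul, Complex.exp_eq_one_iff]
    refine ⟨(r : ℤ) - p, ?_⟩
    push_cast
    field_simp
  have hsum : ∑ j ∈ Finset.range (k + 1), z ^ j = 0 := by
    rw [geom_sum_eq hz1, hzk]; simp
  rw [hsum, zero_smul, smul_zero]

/-- `∂̄ : A^{p,q} → A^{p,q+1}`, the component of type `(p, q+1)` of the exterior derivative. -/
def dbar (a b c : ℝ) (p q : ℕ) (ψ : Form (p + q)) : Form (p + (q + 1)) :=
  fun x => typeProj (J a b c x) p (q + 1) (extDeriv ψ x)

/-! ### The `L²` product, the Laplacian `Δ_∂̄` and the Hodge numbers -/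

/-- The Hermitian product induced by `g` on complex-valued `k`-covectors at `x`:
`∑_{i₁ < ⋯ < i_k} α(u_{i₁}, …, u_{i_k}) · conj β(u_{i₁}, …, u_{i_k})` for a `g`-orthonormal
frame `u`. -/
def hermProd (a b c : ℝ) (x : E) {k : ℕ} (α β : E [⋀^Fin k]→L[ℝ] ℂ) : ℂ :=
  (1 / (k.factorial : ℂ)) * ∑ I : Fin k → Fin 6,
    α (fun i => orthoFrame a b c x (I i)) *
      (starRingEnd ℂ) (β (fun i => orthoFrame a b c x (I i)))

/-- The density of the Riemannian volume of `g` with respect to Lebesgue measure in coordinates. -/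
def volDensity (a b c : ℝ) (x : E) : ℝ :=
  Real.sqrt (Matrix.det (Matrix.of fun i j : Fin 6 =>
    metric a b c x (Pi.single i 1) (Pi.single j 1)))

/-- The `L²` Hermitian product of forms on `X`. -/
def l2Prod (D : LatticeData) (a b c : ℝ) {k : ℕ} (α β : Form k) : ℂ :=
  ∫ x in D.fundDomain, hermProd a b c x (α x) (β x) * (volDensity a b c x : ℂ)

/-- `ξ = ∂̄* η` for a form `η` of type `(p, q+1)`: `ξ` is the form of type `(p,q)` with
`⟨∂̄β, η⟩ = ⟨β, ξ⟩` for every `β ∈ A^{p,q}(X)`. -/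
def IsDbarStar (D : LatticeData) (a b c : ℝ) (p q : ℕ)
    (η : Form (p + (q + 1))) (ξ : Form (p + q)) : Prop :=
  ξ ∈ forms D a b c p q ∧
    ∀ β ∈ forms D a b c p q, l2Prod D a b c (dbar a b c p q β) η = l2Prod D a b c β ξ

/-- `θ = Δ_∂̄ ψ = ∂̄ ∂̄* ψ + ∂̄* ∂̄ ψ` for `ψ ∈ A^{p,q}(X)`. For `q = 0` the first term is absent,
since `∂̄* ψ` lies in `A^{p,-1}(X) = 0`. -/
def IsLaplacian (D : LatticeData) (a b c : ℝ) (p : ℕ) :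
    (q : ℕ) → Form (p + q) → Form (p + q) → Prop
  | 0, ψ, θ => IsDbarStar D a b c p 0 (dbar a b c p 0 ψ) θ
  | q + 1, ψ, θ => ∃ (ξ : Form (p + q)) (ζ : Form (p + (q + 1))),
      IsDbarStar D a b c p q ψ ξ ∧ IsDbarStar D a b c p (q + 1) (dbar a b c p (q + 1) ψ) ζ ∧
        θ = dbar a b c p q ξ + ζ

/-- Auxiliary: continuity of all the coefficients of a form. -/
def EvalCont {k : ℕ} (α : Form k) : Prop :=
  ∀ v : Fin k → E → E, (∀ i, Continuous (v i)) → Continuous fun x => α x (fun i => v i x)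

theorem EvalCont.of_continuous {k : ℕ} {α : Form k} (h : Continuous α) : EvalCont α :=
  fun _ hv => h.eval (continuous_pi hv)

theorem continuous_frame (i : Fin 6) : Continuous fun x => frame x i := by
  refine continuous_pi fun j => ?_
  fin_cases i <;> fin_cases j <;> simp [frame] <;> fun_prop

theorem continuous_coframe (i : Fin 6) {v : E → E} (hv : Continuous v) :
    Continuous fun x => coframe x i (v x) := by
  fin_cases i <;> simp [coframe] <;> fun_prop

theorem continuous_J (a b c : ℝ) {v : E → E} (hv : Continuous v) :
    Continuous fun x => J a b c x (v x) := by
  have hf := continuous_frame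
  simp only [J, sum_apply, ContinuousLinearMap.smulRight_apply]
  refine continuous_finsetSum _ fun i _ => (continuous_coframe i hv).smul ?_
  fin_cases i <;> simp <;> fun_prop

theorem continuous_orthoFrame (a b c : ℝ) (i : Fin 6) :
    Continuous fun x => orthoFrame a b c x i := by
  have hf := continuous_frame
  fin_cases i <;> simp [orthoFrame] <;> fun_prop

theorem continuous_volDensity (a b c : ℝ) : Continuous (volDensity a b c) := by
  refine Real.continuous_sqrt.comp (Continuous.matrix_det ?_)
  refine continuous_pi fun i => continuous_pi fun j => ?_
  have h1 : ∀ l, Continuous fun x => coframe x l (Pi.single i 1) :=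
    fun l => continuous_coframe l continuous_const
  have h2 : ∀ l, Continuous fun x => coframe x l (J a b c x (Pi.single j 1)) :=
    fun l => continuous_coframe l (continuous_J a b c continuous_const)
  simp only [Matrix.of_apply, metric, omega, wedge₂]
  fun_prop

theorem LatticeData.exists_isCompact_fundDomain (D : LatticeData) :
    ∃ K : Set E, IsCompact K ∧ D.fundDomain ⊆ K := by
  let f : E → E := fun s => ![D.a₀ * s 0, s 1,
    (D.P : Matrix (Fin 2) (Fin 2) ℝ).mulVec ![s 2, s 3] 0,
    (D.P : Matrix (Fin 2) (Fin 2) ℝ).mulVec ![s 2, s 3] 1,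
    (D.P : Matrix (Fin 2) (Fin 2) ℝ).mulVec ![s 4, s 5] 0,
    (D.P : Matrix (Fin 2) (Fin 2) ℝ).mulVec ![s 4, s 5] 1]
  have hf : Continuous f := by
    refine continuous_pi fun i => ?_
    fin_cases i <;> simp [f, Matrix.mulVec, dotProduct] <;> fun_prop
  refine ⟨f '' Set.Icc 0 1, isCompact_Icc.image hf, ?_⟩
  rintro g ⟨s, hs, h0, h1, h2, h3⟩
  refine ⟨s, ⟨fun i => (hs i).1, fun i => (hs i).2.le⟩, ?_⟩
  have e2 := congrFun h2 0
  have e3 := congrFun h2 1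
  have e4 := congrFun h3 0
  have e5 := congrFun h3 1
  ext i
  fin_cases i
  · exact h0.symm
  · exact h1.symm
  · exact e2.symm
  · exact e3.symm
  · exact e4.symm
  · exact e5.symm

theorem integrable_hermProd (D : LatticeData) (a b c : ℝ) {k : ℕ} {α β : Form k}
    (hα : EvalCont α) (hβ : EvalCont β) :
    IntegrableOn (fun x => hermProd a b c x (α x) (β x) * (volDensity a b c x : ℂ))
      D.fundDomain := by
  obtain ⟨K, hK, hDK⟩ := D.exists_isCompact_fundDomain
  refine IntegrableOn.mono_set (ContinuousOn.integrableOn_compact hK ?_) hDK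
  refine Continuous.continuousOn ?_
  refine Continuous.mul ?_ (Complex.continuous_ofReal.comp (continuous_volDensity a b c))
  refine continuous_const.mul (continuous_finsetSum _ fun I _ => ?_)
  exact (hα _ fun i => continuous_orthoFrame a b c (I i)).mul
    (Complex.continuous_conj.comp (hβ _ fun i => continuous_orthoFrame a b c (I i)))

theorem l2Prod_add_right (D : LatticeData) (a b c : ℝ) {k : ℕ} {α β β' : Form k}
    (hα : EvalCont α) (hβ : EvalCont β) (hβ' : EvalCont β') :
    l2Prod D a b c α (β + β') = l2Prod D a b c α β + l2Prod D a b c α β' := by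
  unfold l2Prod
  rw [← integral_add (integrable_hermProd D a b c hα hβ) (integrable_hermProd D a b c hα hβ')]
  congr 1
  ext x
  simp only [hermProd, Pi.add_apply, ContinuousAlternatingMap.add_apply, map_add, mul_add,
    Finset.sum_add_distrib, add_mul]

theorem l2Prod_smul_right (D : LatticeData) (a b c : ℝ) {k : ℕ} (r : ℂ) (α β : Form k) :
    l2Prod D a b c α (r • β) = (starRingEnd ℂ) r * l2Prod D a b c α β := by
  unfold l2Prod
  rw [← integral_const_mul]
  congr 1
  ext x
  simp only [hermProd, Pi.smul_apply, ContinuousAlternatingMap.smul_apply, smul_eq_mul, map_mul,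
    Finset.mul_sum, Finset.sum_mul]
  refine Finset.sum_congr rfl fun I _ => ?_
  ring

theorem EvalCont.of_mem {D : LatticeData} {a b c : ℝ} {p q : ℕ} {ψ : Form (p + q)}
    (h : ψ ∈ forms D a b c p q) : EvalCont ψ := .of_continuous h.1.continuous

theorem EvalCont.dbar {D : LatticeData} {a b c : ℝ} {p q : ℕ} {ψ : Form (p + q)}
    (h : ψ ∈ forms D a b c p q) : EvalCont (dbar a b c p q ψ) := by
  have h1 : Continuous (extDeriv ψ) :=
    (ContinuousAlternatingMap.alternatizeUncurryFinCLM ℝ E ℂ).continuous.comp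
      (h.1.continuous_fderiv (by simp))
  intro v hv
  simp only [Solvmanifold.dbar, typeProj, ContinuousAlternatingMap.smul_apply,
    ContinuousAlternatingMap.sum_apply, ContinuousAlternatingMap.compContinuousLinearMap_apply]
  refine Continuous.const_smul (continuous_finsetSum _ fun j _ => ?_) (_ : ℂ)
  refine Continuous.const_smul ?_ (_ : ℂ)
  have h2 : EvalCont (extDeriv ψ) := EvalCont.of_continuous h1
  exact h2 (fun i x => Real.cos (Real.pi * j / ((p + (q + 1) : ℕ) + 1)) • v i x
      + Real.sin (Real.pi * j / ((p + (q + 1) : ℕ) + 1)) • J a b c x (v i x))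
    fun i => Continuous.fun_add ((hv i).fun_const_smul _)
      ((continuous_J a b c (hv i)).fun_const_smul _)

theorem dbar_add {D : LatticeData} {a b c : ℝ} {p q : ℕ} {ψ χ : Form (p + q)}
    (hψ : ψ ∈ forms D a b c p q) (hχ : χ ∈ forms D a b c p q) :
    dbar a b c p q (ψ + χ) = dbar a b c p q ψ + dbar a b c p q χ := by
  funext x
  have h1 : DifferentiableAt ℝ ψ x := (hψ.1.differentiable (by simp)) x
  have h2 : DifferentiableAt ℝ χ x := (hχ.1.differentiable (by simp)) x
  simp only [dbar, Pi.add_apply]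
  rw [extDeriv_add h1 h2, typeProj_add]

theorem dbar_smul {D : LatticeData} {a b c : ℝ} {p q : ℕ} (r : ℂ) {ψ : Form (p + q)}
    (hψ : ψ ∈ forms D a b c p q) :
    dbar a b c p q (r • ψ) = r • dbar a b c p q ψ := by
  funext x
  have h1 : DifferentiableAt ℝ ψ x := (hψ.1.differentiable (by simp)) x
  have h2 : extDeriv (r • ψ) x = r • extDeriv ψ x := by
    have h3 : DifferentiableAt ℝ (r • ψ) x := h1.const_smul r
    ext v
    rw [extDeriv_apply h3, ContinuousAlternatingMap.smul_apply, extDeriv_apply h1,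
      Finset.smul_sum]
    refine Finset.sum_congr rfl fun i _ => ?_
    have h4 : DifferentiableAt ℝ (fun x => ψ x (i.removeNth v)) x :=
      (ContinuousAlternatingMap.apply ℝ E ℂ (i.removeNth v)).differentiableAt.comp x h1
    have h5 : (fun x => (r • ψ) x (i.removeNth v)) = r • fun x => ψ x (i.removeNth v) := rfl
    rw [h5, fderiv_const_smul h4, smul_comm]
    rfl
  simp only [dbar, Pi.smul_apply]
  rw [h2, typeProj_smul]

theorem IsDbarStar.add {D : LatticeData} {a b c : ℝ} {p q : ℕ} {η η' : Form (p + (q + 1))}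
    {ξ ξ' : Form (p + q)} (hη : EvalCont η) (hη' : EvalCont η')
    (h : IsDbarStar D a b c p q η ξ) (h' : IsDbarStar D a b c p q η' ξ') :
    IsDbarStar D a b c p q (η + η') (ξ + ξ') := by
  refine ⟨Submodule.add_mem _ h.1 h'.1, fun β hβ => ?_⟩
  rw [l2Prod_add_right D a b c (.dbar hβ) hη hη',
    l2Prod_add_right D a b c (.of_mem hβ) (.of_mem h.1) (.of_mem h'.1), h.2 β hβ, h'.2 β hβ]

theorem IsDbarStar.smul {D : LatticeData} {a b c : ℝ} {p q : ℕ} {η : Form (p + (q + 1))}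
    {ξ : Form (p + q)} (r : ℂ) (h : IsDbarStar D a b c p q η ξ) :
    IsDbarStar D a b c p q (r • η) (r • ξ) := by
  refine ⟨Submodule.smul_mem _ _ h.1, fun β hβ => ?_⟩
  rw [l2Prod_smul_right, l2Prod_smul_right, h.2 β hβ]

theorem IsLaplacian.add {D : LatticeData} {a b c : ℝ} {p q : ℕ} {ψ ψ' θ θ' : Form (p + q)}
    (hψ : ψ ∈ forms D a b c p q) (hψ' : ψ' ∈ forms D a b c p q)
    (h : IsLaplacian D a b c p q ψ θ) (h' : IsLaplacian D a b c p q ψ' θ') :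
    IsLaplacian D a b c p q (ψ + ψ') (θ + θ') := by
  cases q with
  | zero =>
    have := IsDbarStar.add (.dbar hψ) (.dbar hψ') h h'
    rw [← dbar_add hψ hψ'] at this
    exact this
  | succ q =>
    obtain ⟨ξ, ζ, h1, h2, h3⟩ := h
    obtain ⟨ξ', ζ', h1', h2', h3'⟩ := h'
    have := IsDbarStar.add (.dbar hψ) (.dbar hψ') h2 h2'
    rw [← dbar_add hψ hψ'] at this
    refine ⟨ξ + ξ', ζ + ζ', IsDbarStar.add (.of_mem hψ) (.of_mem hψ') h1 h1', this, ?_⟩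
    rw [h3, h3', dbar_add h1.1 h1'.1]
    exact add_add_add_comm _ _ _ _

theorem IsLaplacian.smul {D : LatticeData} {a b c : ℝ} {p q : ℕ} {ψ θ : Form (p + q)} (r : ℂ)
    (hψ : ψ ∈ forms D a b c p q) (h : IsLaplacian D a b c p q ψ θ) :
    IsLaplacian D a b c p q (r • ψ) (r • θ) := by
  cases q with
  | zero =>
    have := IsDbarStar.smul r h
    rw [← dbar_smul r hψ] at this
    exact this
  | succ q =>
    obtain ⟨ξ, ζ, h1, h2, h3⟩ := h
    have := IsDbarStar.smul r h2
    rw [← dbar_smul r hψ] at this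
    refine ⟨r • ξ, r • ζ, IsDbarStar.smul r h1, this, ?_⟩
    rw [h3, dbar_smul r h1.1]
    exact smul_add r _ _

/-- `ℋ^{p,q}_∂̄(X)`, the kernel of `Δ_∂̄` on `A^{p,q}(X)`. -/
def harmonic (D : LatticeData) (a b c : ℝ) (p q : ℕ) : Submodule ℂ (Form (p + q)) where
  carrier := {ψ | ψ ∈ forms D a b c p q ∧ IsLaplacian D a b c p q ψ 0}
  zero_mem' := by
    have hd : ∀ q, dbar a b c p q 0 = 0 := fun q => by
      have := dbar_smul (D := D) (a := a) (b := b) (c := c) 0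
        (Submodule.zero_mem (forms D a b c p q))
      have e : (0 : ℂ) • (0 : Form (p + q)) = 0 := by ext; simp
      have e' : (0 : ℂ) • dbar a b c p q 0 = 0 := by ext; simp
      rwa [e, e'] at this
    have h0 : ∀ q, IsDbarStar D a b c p q 0 0 := fun q =>
      ⟨Submodule.zero_mem _, fun β hβ => by simp [l2Prod, hermProd]⟩
    refine ⟨Submodule.zero_mem _, ?_⟩
    cases q with
    | zero =>
      change IsDbarStar D a b c p 0 (dbar a b c p 0 0) 0
      rw [hd]
      exact h0 0
    | succ q =>
      refine ⟨0, 0, h0 q, ?_, ?_⟩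
      · rw [hd]
        exact h0 (q + 1)
      · rw [hd]
        exact (add_zero _).symm
  add_mem' := by
    rintro ψ χ ⟨h1, h2⟩ ⟨h1', h2'⟩
    refine ⟨Submodule.add_mem _ h1 h1', ?_⟩
    have := IsLaplacian.add h1 h1' h2 h2'
    rwa [add_zero] at this
  smul_mem' := by
    rintro r ψ ⟨h1, h2⟩
    refine ⟨Submodule.smul_mem _ r h1, ?_⟩
    have := IsLaplacian.smul r h1 h2
    have e : r • (0 : Form (p + q)) = 0 := by ext; simp
    rwa [e] at this

/-- The Hodge number `h^{p,q}_∂̄`, the complex dimension of `ℋ^{p,q}_∂̄(X)`, as a cardinal. -/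
def hodgeNumber (D : LatticeData) (a b c : ℝ) (p q : ℕ) : Cardinal :=
  Module.rank ℂ (harmonic D a b c p q)

end Solvmanifold

end

/-
Since `∂̄*` vanishes on `(p,0)`-forms, a form `ψ` of type `(p,0)` is harmonic if and only if
`∂̄*∂̄ψ = 0`, that is `∂̄ψ = 0` because `⟨∂̄ψ, ∂̄ψ⟩ = ⟨ψ, ∂̄*∂̄ψ⟩`. In the left-invariant coframe of
type `(1,0)` this is a first-order system for the coefficients of `ψ`, which are smooth functions on
`G`, invariant under `Γ`, hence bounded. The planes spanned by a left-invariant field and its image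
under `J` are complex lines on which `Z̄_j` is the Cauchy–Riemann operator, so Liouville's theorem
makes a coefficient annihilated by `Z̄₂` and `Z̄₃` constant on the fibres of `G → ℝ²`, and a bounded
function with `Z̄_j f` constant has `Z̄_j f = 0`. Everything thereby reduces to the base. In degrees
1 and 3 only constants survive. In degree 2 the coefficients of `θ₁ ∧ θ₂` and `θ₁ ∧ θ₃` satisfy
`Z̄₁ f = c/4 g`, `Z̄₁ g = c/4 f`, so `f ± g` is a multiple of `e^{∓icx/2}`, which is
invariant under `x ↦ x + 1` if and only if `c ∈ 4πℤ`.
-/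

noncomputable section

namespace Solvmanifold

open scoped ContDiff
open MeasureTheory

section Complexification

variable {V : Type*} [AddCommGroup V] [Module ℝ V] [TopologicalSpace V] {n ι : Type*} [Fintype n]
  [Fintype ι] [DecidableEq ι]

theorem sum_apply_mul_prod_eq_zero (e : n → V) (α : V [⋀^ι]→L[ℝ] ℂ)
    {w : ι → n → ℂ} {i j : ι} (hw : w i = w j) (hij : i ≠ j) :
    ∑ I : ι → n, α (e ∘ I) * ∏ m, w m (I m) = 0 := by
  refine self_eq_neg.mp ?_
  conv_lhs => rw [← ((Equiv.swap i j).arrowCongr (Equiv.refl n)).sum_comp]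
  rw [← Finset.sum_neg_distrib]
  refine Finset.sum_congr rfl fun I _ => ?_
  have hα : α (e ∘ I ∘ Equiv.swap i j) = -α (e ∘ I) :=
    α.toAlternatingMap.map_swap (e ∘ I) hij
  have hprod : ∏ m, w m (I (Equiv.swap i j m)) = ∏ m, w m (I m) := by
    rw [← Equiv.prod_comp (Equiv.swap i j)]
    refine Finset.prod_congr rfl fun m _ => ?_
    rw [Equiv.swap_apply_self]
    rcases eq_or_ne m i with rfl | hi
    · rw [Equiv.swap_apply_left, hw]
    rcases eq_or_ne m j with rfl | hj
    · rw [Equiv.swap_apply_right, hw]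
    rw [Equiv.swap_apply_of_ne_of_ne hi hj]
  rw [← neg_mul, ← hα, ← hprod]
  rfl

variable (e : Module.Basis n ℝ V)

/-- The `ℂ`-multilinear extension of a complex-valued real covector to the complexification of the
space. A vector of the complexification is encoded by its complex coordinates in the real
basis `e`. -/
def complexify : (V [⋀^ι]→L[ℝ] ℂ) →ₗ[ℂ] (n → ℂ) [⋀^ι]→ₗ[ℂ] ℂ where
  toFun α :=
    { ∑ I : ι → n, α (e ∘ I) • (MultilinearMap.mkPiAlgebra ℂ ι ℂ).compLinearMap
        (fun m => LinearMap.proj (I m)) with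
      map_eq_zero_of_eq' := fun w i j hw hij => by
        simpa using sum_apply_mul_prod_eq_zero e α hw hij }
  map_add' α β := by
    ext w
    simp [add_mul, Finset.sum_add_distrib]
  map_smul' r α := by
    ext w
    simp [Finset.mul_sum, mul_assoc]

theorem complexify_apply (α : V [⋀^ι]→L[ℝ] ℂ) (w : ι → n → ℂ) :
    complexify e α w = ∑ I : ι → n, α (e ∘ I) * ∏ m, w m (I m) := by
  simp [complexify]

theorem complexify_sum_apply {κ : Type*} (s : Finset κ) (α : κ → V [⋀^ι]→L[ℝ] ℂ)
    (w : ι → n → ℂ) : complexify e (∑ i ∈ s, α i) w = ∑ i ∈ s, complexify e (α i) w := by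
  simp only [complexify_apply, ContinuousAlternatingMap.sum_apply, Finset.sum_mul]
  exact Finset.sum_comm

theorem apply_eq_sum_repr (α : V [⋀^ι]→L[ℝ] ℂ) (v : ι → V) :
    α v = ∑ I : ι → n, α (e ∘ I) * ∏ m, (e.repr (v m) (I m) : ℂ) := by
  have expand : α v = ∑ I : ι → n, α fun m => e.repr (v m) (I m) • e (I m) := by
    conv_lhs => rw [show v = fun m => ∑ i, e.repr (v m) i • e i from
      funext fun m => (e.sum_repr (v m)).symm]
    exact α.toMultilinearMap.map_sum _
  rw [expand]
  refine Finset.sum_congr rfl fun I _ => ?_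
  rw [← Complex.ofReal_prod, mul_comm, ← Complex.real_smul]
  exact α.toMultilinearMap.map_smul_univ _ _

theorem complexify_ofReal_repr (α : V [⋀^ι]→L[ℝ] ℂ) (v : ι → V) :
    complexify e α (fun m i => (e.repr (v m) i : ℂ)) = α v := by
  rw [complexify_apply, apply_eq_sum_repr e]

theorem complexify_injective : Function.Injective (complexify e (ι := ι)) := by
  intro α β h
  ext v
  rw [← complexify_ofReal_repr e α, ← complexify_ofReal_repr e β, h]

/-- The `ℂ`-linear extension of a real endomorphism to the complexification, in the
coordinates of `complexify`. -/
def complexifyEnd (T : V →L[ℝ] V) : (n → ℂ) →ₗ[ℂ] (n → ℂ) :=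
  Fintype.linearCombination ℂ fun i j => (e.repr (T (e i)) j : ℂ)

theorem complexifyEnd_apply (T : V →L[ℝ] V) (w : n → ℂ) (j : n) :
    complexifyEnd e T w j = ∑ i, w i * (e.repr (T (e i)) j : ℂ) := by
  simp [complexifyEnd, Fintype.linearCombination_apply]

theorem complexify_compContinuousLinearMap (α : V [⋀^ι]→L[ℝ] ℂ) (T : V →L[ℝ] V) (w : ι → n → ℂ) :
    complexify e (α.compContinuousLinearMap T) w
      = complexify e α fun m => complexifyEnd e T (w m) := by
  simp only [complexify_apply, complexifyEnd_apply, Finset.prod_univ_sum, Fintype.piFinset_univ,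
    Finset.mul_sum, ContinuousAlternatingMap.compContinuousLinearMap_apply]
  rw [Finset.sum_comm]
  refine Finset.sum_congr rfl fun I _ => ?_
  rw [apply_eq_sum_repr e, Finset.sum_mul]
  refine Finset.sum_congr rfl fun K _ => ?_
  simp only [Function.comp_apply, Finset.prod_mul_distrib]
  ring

/-- The `ℂ`-linear extension of a real `1`-covector to the complexification, in the
coordinates of `complexify`. -/
def complexifyFunctional (φ : V →L[ℝ] ℂ) : (n → ℂ) →ₗ[ℂ] ℂ :=
  Fintype.linearCombination ℂ fun i => φ (e i)

theorem complexifyFunctional_apply (φ : V →L[ℝ] ℂ) (w : n → ℂ) :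
    complexifyFunctional e φ w = ∑ i, w i * φ (e i) := by
  simp [complexifyFunctional, Fintype.linearCombination_apply]

theorem complexifyFunctional_complexifyEnd {T : V →L[ℝ] V} {φ : V →L[ℝ] ℂ} {r : ℂ}
    (h : ∀ v, φ (T v) = r * φ v) (w : n → ℂ) :
    complexifyFunctional e φ (complexifyEnd e T w) = r * complexifyFunctional e φ w := by
  have expand : ∀ v, φ v = ∑ i, (e.repr v i : ℂ) * φ (e i) := fun v => by
    conv_lhs => rw [← e.sum_repr v]
    simp only [map_sum, map_smul, Complex.real_smul]
  simp only [complexifyFunctional_apply, complexifyEnd_apply, Finset.sum_mul, Finset.mul_sum]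
  rw [Finset.sum_comm]
  refine Finset.sum_congr rfl fun i _ => ?_
  simp only [mul_left_comm r, ← h, expand (T (e i)), Finset.mul_sum, mul_assoc]

theorem complexify_of_eq_det {k : ℕ} {α : V [⋀^Fin k]→L[ℝ] ℂ} {φ : Fin k → (V →L[ℝ] ℂ)}
    (h : ∀ v, α v = Matrix.det (Matrix.of fun i j => φ i (v j))) (w : Fin k → n → ℂ) :
    complexify e α w = Matrix.det (Matrix.of fun i j => complexifyFunctional e (φ i) (w j)) := by
  simp only [complexify_apply, complexifyFunctional_apply, h, Matrix.det_apply', Finset.sum_mul,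
    Matrix.of_apply, Finset.prod_univ_sum, Fintype.piFinset_univ, Finset.mul_sum]
  rw [Finset.sum_comm]
  refine Finset.sum_congr rfl fun σ _ => Finset.sum_congr rfl fun I _ => ?_
  rw [Finset.prod_mul_distrib]
  simp only [Function.comp_apply]
  ring

end Complexification

section Types

theorem sum_zpow_pow_of_isPrimitiveRoot {K : Type*} [Field K] {ζ : K} {n : ℕ}
    (hζ : IsPrimitiveRoot ζ n) (d : ℤ) :
    ∑ j ∈ Finset.range n, (ζ ^ d) ^ j = if (n : ℤ) ∣ d then (n : K) else 0 := by
  split_ifs with hd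
  · simp [(hζ.zpow_eq_one_iff_dvd d).mpr hd]
  · have hne : ζ ^ d ≠ 1 := mt (hζ.zpow_eq_one_iff_dvd d).mp hd
    have hpow : (ζ ^ d) ^ n = 1 := by
      rw [← zpow_natCast, zpow_comm, zpow_natCast, hζ.pow_eq_one, one_zpow]
    rw [geom_sum_eq hne, hpow, sub_self, zero_div]

variable {J : E →L[ℝ] E} {n : Type*} [Fintype n] (e : Module.Basis n ℝ E) {k : ℕ}

theorem complexifyEnd_rotation (J : E →L[ℝ] E) (r s : ℝ) (v : n → ℂ) :
    complexifyEnd e (r • ContinuousLinearMap.id ℝ E + s • J) v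
      = (r : ℂ) • v + (s : ℂ) • complexifyEnd e J v := by
  classical
  funext j
  simp only [complexifyEnd_apply, Pi.add_apply, Pi.smul_apply, add_apply, smul_apply,
    ContinuousLinearMap.id_apply, map_add, map_smul, Finsupp.add_apply, Finsupp.smul_apply,
    Module.Basis.repr_self, Finsupp.single_apply, smul_eq_mul, Complex.ofReal_add,
    Complex.ofReal_mul, mul_add, Finset.sum_add_distrib, Finset.mul_sum]
  simp [apply_ite (Complex.ofReal), mul_comm, mul_left_comm]

theorem complexify_rotation (α : E [⋀^Fin k]→L[ℝ] ℂ) (θ : ℝ) {w : Fin k → n → ℂ}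
    {S : Finset (Fin k)}
    (hw : ∀ m, complexifyEnd e J (w m) = (if m ∈ S then Complex.I else -Complex.I) • w m) :
    complexify e (α.compContinuousLinearMap
        (Real.cos θ • ContinuousLinearMap.id ℝ E + Real.sin θ • J)) w
      = Complex.exp ((2 * S.card - k) * θ * Complex.I) * complexify e α w := by
  have hrot : ∀ m, complexifyEnd e (Real.cos θ • ContinuousLinearMap.id ℝ E + Real.sin θ • J) (w m)
      = Complex.exp (((if m ∈ S then 2 else 0) - 1) * θ * Complex.I) • w m := by
    intro m
    rw [complexifyEnd_rotation, hw, smul_smul, ← add_smul, Complex.exp_mul_I]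
    split_ifs <;> norm_num
  rw [complexify_compContinuousLinearMap, funext hrot]
  rw [(complexify e α).map_smul_univ, ← Complex.exp_sum, smul_eq_mul, ← Finset.sum_mul,
    ← Finset.sum_mul, Finset.sum_sub_distrib]
  simp [mul_comm]

theorem complexify_typeProj (α : E [⋀^Fin k]→L[ℝ] ℂ) {p q : ℕ} (hpq : p + q = k)
    {w : Fin k → n → ℂ} {S : Finset (Fin k)}
    (hw : ∀ m, complexifyEnd e J (w m) = (if m ∈ S then Complex.I else -Complex.I) • w m) :
    complexify e (typeProj J p q α) w = if S.card = p then complexify e α w else 0 := by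
  have hk : (k : ℂ) + 1 ≠ 0 := Nat.cast_add_one_ne_zero k
  have hS : S.card ≤ k := by simpa using S.card_le_univ
  have hζ := Complex.isPrimitiveRoot_exp (k + 1) k.succ_ne_zero
  have hdvd : ((k + 1 : ℕ) : ℤ) ∣ (S.card : ℤ) - p ↔ S.card = p := by
    refine ⟨fun h => ?_, fun h => by simp [h]⟩
    have := Int.eq_zero_of_abs_lt_dvd h (abs_lt.mpr ⟨by omega, by omega⟩)
    omega
  have hterm : ∀ j : ℕ, Complex.exp (-(((p : ℂ) - q) * (Real.pi * j / (k + 1) : ℝ) * Complex.I))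
      * Complex.exp ((2 * S.card - k) * (Real.pi * j / (k + 1) : ℝ) * Complex.I)
        = (Complex.exp (2 * Real.pi * Complex.I / (k + 1 : ℕ)) ^ ((S.card : ℤ) - p)) ^ j := by
    intro j
    rw [← Complex.exp_add, ← Complex.exp_int_mul, ← Complex.exp_nat_mul]
    congr 1
    have hk' : (k : ℂ) = p + q := by rw [← hpq, Nat.cast_add]
    rw [show (q : ℂ) = k - p by rw [hk']; ring]
    push_cast
    field_simp
    ring
  simp only [typeProj, map_smul, AlternatingMap.smul_apply, complexify_sum_apply,
    complexify_rotation e α _ hw, smul_eq_mul, ← mul_assoc, hterm]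
  rw [← Finset.sum_mul, sum_zpow_pow_of_isPrimitiveRoot hζ]
  simp only [hdvd]
  split_ifs
  · simp [hk]
  · simp

theorem exists_perm_comp_eq_vecCons_inr {κ κ' : Type*} {p : ℕ} {v : Fin (p + 1) → κ ⊕ κ'}
    (hv : (Finset.univ.filter fun m => (v m).isLeft).card = p) :
    ∃ (σ : Equiv.Perm (Fin (p + 1))) (j : κ') (I : Fin p → κ),
      v ∘ σ = Matrix.vecCons (Sum.inr j) (Sum.inl ∘ I) := by
  have hone : (Finset.univ.filter fun m => ¬ (v m).isLeft).card = 1 := by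
    have := Finset.card_filter_add_card_filter_not (s := (Finset.univ : Finset (Fin (p + 1))))
      fun m => ((v m).isLeft : Prop)
    rw [hv, Finset.card_univ, Fintype.card_fin] at this
    omega
  obtain ⟨m₀, hm₀⟩ := Finset.card_eq_one.mp hone
  have hright : ∀ m, ¬ (v m).isLeft ↔ m = m₀ := fun m => by
    simpa using Finset.ext_iff.mp hm₀ m
  obtain ⟨j, hj⟩ : ∃ j, v m₀ = Sum.inr j := by
    simpa [Sum.isRight_iff] using (hright m₀).mpr rfl
  have hleft : ∀ m : Fin p, ∃ i, v (Equiv.swap 0 m₀ m.succ) = Sum.inl i := fun m => by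
    rw [← Sum.isLeft_iff, ← not_not (a := ((v _).isLeft : Prop)), hright]
    intro h
    exact Fin.succ_ne_zero m
      ((Equiv.swap 0 m₀).injective (h.trans (Equiv.swap_apply_left 0 m₀).symm))
  choose I hI using hleft
  refine ⟨Equiv.swap 0 m₀, j, I, funext fun m => ?_⟩
  cases m using Fin.cases with
  | zero => simp [hj]
  | succ m => simp [hI]

variable {κ κ' : Type*} {B : Module.Basis (κ ⊕ κ') ℂ (n → ℂ)}

theorem typeProj_one_eq_zero_iff
    (hleft : ∀ i, complexifyEnd e J (B (Sum.inl i)) = Complex.I • B (Sum.inl i))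
    (hright : ∀ i, complexifyEnd e J (B (Sum.inr i)) = -Complex.I • B (Sum.inr i)) {p : ℕ}
    (α : E [⋀^Fin (p + 1)]→L[ℝ] ℂ) :
    typeProj J p 1 α = 0 ↔ ∀ (j : κ') (I : Fin p → κ),
      complexify e α (B ∘ Matrix.vecCons (Sum.inr j) (Sum.inl ∘ I)) = 0 := by
  have htype : ∀ v : Fin (p + 1) → κ ⊕ κ', complexify e (typeProj J p 1 α) (B ∘ v)
      = if (Finset.univ.filter fun m => (v m).isLeft).card = p
        then complexify e α (B ∘ v) else 0 := by
    intro v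
    refine complexify_typeProj e α rfl fun m => ?_
    rcases hm : v m with i | i <;> simp [hm, hleft, hright]
  constructor
  · intro h j I
    have hcard : (Finset.univ.filter fun m =>
        (Matrix.vecCons (Sum.inr j) (Sum.inl ∘ I) m : κ ⊕ κ').isLeft).card = p := by
      simp [Fin.card_filter_univ_succ]
    simpa only [if_pos hcard, h, map_zero, AlternatingMap.zero_apply] using
      (htype (Matrix.vecCons (Sum.inr j) (Sum.inl ∘ I))).symm
  · intro h
    refine complexify_injective e (B.ext_alternating fun v _ => ?_)
    change complexify e _ (B ∘ v) = _
    rw [htype, map_zero]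
    split_ifs with hv
    · obtain ⟨σ, j, I, hσ⟩ := exists_perm_comp_eq_vecCons_inr hv
      have hperm := (complexify e α).map_perm (B ∘ v) σ
      rw [Function.comp_assoc, hσ, h] at hperm
      exact ((smul_eq_zero_iff_eq _).mp hperm.symm)
    · rfl

theorem complexify_eq_zero_of_mem_bigraded {p : ℕ} {α : E [⋀^Fin p]→L[ℝ] ℂ}
    (hα : α ∈ bigraded J p p 0) {w : Fin p → n → ℂ} {m : Fin p}
    (hw : complexifyEnd e J (w m) = -Complex.I • w m) : complexify e α w = 0 := by
  induction hα using Submodule.span_induction with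
  | mem α h =>
    obtain ⟨-, φ, h10, -, hdet⟩ := h
    rw [complexify_of_eq_det e hdet]
    refine Matrix.det_eq_zero_of_column_eq_zero m fun i => ?_
    have heigen := complexifyFunctional_complexifyEnd e (h10 i i.2) (w m)
    rw [hw, map_smul, smul_eq_mul, neg_mul, neg_eq_iff_add_eq_zero, ← two_mul] at heigen
    simpa using heigen
  | zero => simp
  | add α β _ _ hα hβ => simp [hα, hβ]
  | smul r α _ hα => simp [hα]

theorem eq_zero_of_mem_bigraded
    (hright : ∀ i, complexifyEnd e J (B (Sum.inr i)) = -Complex.I • B (Sum.inr i)) {p : ℕ}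
    {α : E [⋀^Fin p]→L[ℝ] ℂ} (hα : α ∈ bigraded J p p 0)
    (h : ∀ I : Fin p → κ, complexify e α (B ∘ Sum.inl ∘ I) = 0) : α = 0 := by
  refine complexify_injective e (B.ext_alternating fun v _ => ?_)
  rw [map_zero, AlternatingMap.zero_apply]
  by_cases hv : ∀ m, ∃ i, v m = Sum.inl i
  · choose I hI using hv
    rw [← h I]
    simp only [Function.comp_def, hI]
  · push Not at hv
    obtain ⟨m, hm⟩ := hv
    rcases hv : v m with i | i
    · exact absurd hv (hm i)
    · exact complexify_eq_zero_of_mem_bigraded e hα (m := m) (by rw [hv, hright])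

end Types

section Cartan

theorem sum_eq_sum_insertNth {M n : Type*} [AddCommMonoid M] [Fintype n] {k : ℕ} (i : Fin (k + 1))
    (g : (Fin (k + 1) → n) → M) :
    ∑ I, g I = ∑ l, ∑ I : Fin k → n, g (i.insertNth l I) := by
  rw [← (Fin.insertNthEquiv (fun _ => n) i).sum_comp, Fintype.sum_prod_type]
  rfl

theorem complexify_vecCons_repr {V : Type*} [AddCommGroup V] [Module ℝ V] [TopologicalSpace V]
    {n : Type*} [Fintype n] (e : Module.Basis n ℝ V) {k : ℕ} (α : V [⋀^Fin (k + 1)]→L[ℝ] ℂ)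
    (u : V) (w : Fin k → n → ℂ) :
    complexify e α (Matrix.vecCons (fun i => (e.repr u i : ℂ)) w)
      = ∑ I : Fin k → n, α (Matrix.vecCons u (e ∘ I)) * ∏ m, w m (I m) := by
  have expand : ∀ I : Fin k → n, α (Matrix.vecCons u (e ∘ I))
      = ∑ l, (e.repr u l : ℂ) * α (Matrix.vecCons (e l) (e ∘ I)) := by
    intro I
    conv_lhs => rw [← e.sum_repr u]
    have expand := map_sum (α.toMultilinearMap.curryLeft) (fun l => e.repr u l • e l) Finset.univ
    simpa [Matrix.vecCons] using DFunLike.congr_fun expand (e ∘ I)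
  have hcons : ∀ (l : n) (I : Fin k → n),
      (e ∘ (Fin.insertNth 0 l I : Fin (k + 1) → n)) = Matrix.vecCons (e l) (e ∘ I) := by
    intro l I
    rw [Fin.insertNth_zero', Fin.comp_cons]
    rfl
  rw [complexify_apply, sum_eq_sum_insertNth 0, Finset.sum_comm]
  refine Finset.sum_congr rfl fun I _ => ?_
  rw [expand, Finset.sum_mul]
  refine Finset.sum_congr rfl fun l _ => ?_
  rw [hcons, Fin.prod_univ_succ]
  simp
  ring

variable {V : Type*} [NormedAddCommGroup V] [NormedSpace ℝ V] {n : Type*} [Fintype n]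
  (e : V → Module.Basis n ℝ V) {k : ℕ} (x : V)

/-- The Lie bracket at `x` of two complex combinations, with constant coefficients, of the vector
fields of the frame `e`, in complex coordinates with respect to this frame. -/
def frameBracket (v w : n → ℂ) : n → ℂ :=
  ∑ i, ∑ j, (v i * w j) • fun l =>
    ((e x).repr (VectorField.lieBracket ℝ (fun y => e y i) (fun y => e y j) x) l : ℂ)

theorem complexify_vecCons_frameBracket (α : V [⋀^Fin (k + 1)]→L[ℝ] ℂ) (v v' : n → ℂ)
    (w : Fin k → n → ℂ) :
    complexify (e x) α (Matrix.vecCons (frameBracket e x v v') w)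
      = ∑ i, ∑ j, ∑ I : Fin k → n, v i * v' j *
        (α (Matrix.vecCons (VectorField.lieBracket ℝ (fun y => e y i) (fun y => e y j) x)
          (e x ∘ I)) * ∏ m, w m (I m)) := by
  simp only [← Finset.mul_sum, ← complexify_vecCons_repr]
  change (complexify (e x) α).toMultilinearMap.curryLeft (frameBracket e x v v') w = _
  simp only [frameBracket, map_sum, map_smul, sum_apply, smul_apply, smul_eq_mul]
  rfl

variable {e x}

theorem complexifyFunctional_fderiv_complexify (he : ∀ i, DifferentiableAt ℝ (fun y => e y i) x)
    {ψ : V → V [⋀^Fin k]→L[ℝ] ℂ} (hψ : DifferentiableAt ℝ ψ x) (v : n → ℂ) (w : Fin k → n → ℂ) :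
    complexifyFunctional (e x) (fderiv ℝ (fun y => complexify (e y) (ψ y) w) x) v
      = ∑ l, ∑ I : Fin k → n, v l *
        (fderiv ℝ (fun y => ψ y (e y ∘ I)) x (e x l) * ∏ m, w m (I m)) := by
  have hderiv : HasFDerivAt (fun y => complexify (e y) (ψ y) w) (∑ I : Fin k → n,
      (∏ m, w m (I m)) • fderiv ℝ (fun y => ψ y (e y ∘ I)) x) x := by
    simp only [complexify_apply]
    refine HasFDerivAt.fun_sum fun I _ => ?_
    exact (hψ.continuousAlternatingMap_apply fun m => he (I m)).hasFDerivAt.mul_const _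
  simp only [complexifyFunctional_apply, hderiv.fderiv, sum_apply, smul_apply, smul_eq_mul,
    Finset.mul_sum, mul_comm (∏ m, _)]

/-- Cartan's formula. -/
theorem complexify_extDeriv (he : ∀ i, DifferentiableAt ℝ (fun y => e y i) x)
    {ψ : V → V [⋀^Fin (k + 1)]→L[ℝ] ℂ} (hψ : DifferentiableAt ℝ ψ x) (w : Fin (k + 2) → n → ℂ) :
    complexify (e x) (extDeriv ψ x) w
      = ∑ i, (-1) ^ i.val * complexifyFunctional (e x)
          (fderiv ℝ (fun y => complexify (e y) (ψ y) (i.removeNth w)) x) (w i)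
        - ∑ i : Fin (k + 1), ∑ j ≥ i, (-1) ^ (i + j : ℕ) * complexify (e x) (ψ x)
          (Matrix.vecCons (frameBracket e x (w i.castSucc) (w j.succ))
            (j.removeNth (i.castSucc.removeNth w))) := by
  have cartan := fun I : Fin (k + 2) → n => extDeriv_apply_vectorField hψ fun m => he (I m)
  rw [complexify_apply]
  simp only [Function.comp_def, cartan, sub_mul, Finset.sum_sub_distrib, Finset.sum_mul,
    complexifyFunctional_fderiv_complexify he hψ, complexify_vecCons_frameBracket, Finset.mul_sum]
  congr 1
  · rw [Finset.sum_comm]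
    refine Finset.sum_congr rfl fun i _ => ?_
    rw [sum_eq_sum_insertNth i]
    refine Finset.sum_congr rfl fun l _ => Finset.sum_congr rfl fun I _ => ?_
    have hremove : ∀ y, i.removeNth (fun m => e y (i.insertNth (α := fun _ => n) l I m))
        = e y ∘ I := fun y => funext fun m => by simp [Fin.removeNth]
    simp only [hremove, Fin.insertNth_apply_same, Fin.prod_univ_succAbove _ i,
      Fin.insertNth_apply_succAbove, Fin.removeNth, zsmul_eq_mul, Function.comp_def]
    push_cast
    ring
  · rw [Finset.sum_comm]
    refine Finset.sum_congr rfl fun i _ => ?_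
    rw [Finset.sum_comm]
    refine Finset.sum_congr rfl fun j hj => ?_
    have hij : i.castSucc.succAbove j = j.succ :=
      Fin.succAbove_of_le_castSucc _ _ (by simpa using hj)
    rw [sum_eq_sum_insertNth i.castSucc]
    refine Finset.sum_congr rfl fun l _ => ?_
    rw [sum_eq_sum_insertNth j]
    refine Finset.sum_congr rfl fun l' _ => Finset.sum_congr rfl fun I _ => ?_
    have hremove : j.removeNth (i.castSucc.removeNth fun m => e x (i.castSucc.insertNth
        (α := fun _ => n) l (j.insertNth (α := fun _ => n) l' I) m)) = e x ∘ I :=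
      funext fun m => by simp [Fin.removeNth]
    simp only [hremove, Fin.insertNth_apply_same, Fin.prod_univ_succAbove _ i.castSucc,
      Fin.prod_univ_succAbove _ j, ← hij, Fin.insertNth_apply_succAbove, Fin.removeNth,
      zsmul_eq_mul, Function.comp_def]
    push_cast
    ring

/-- If `ψ` vanishes as soon as one argument is `v`, only the terms of Cartan's formula which involve
the slot of `v` survive. -/
theorem complexify_extDeriv_vecCons (he : ∀ i, DifferentiableAt ℝ (fun y => e y i) x)
    {ψ : V → V [⋀^Fin (k + 1)]→L[ℝ] ℂ} (hψ : DifferentiableAt ℝ ψ x) {v : n → ℂ}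
    (hv : ∀ y w m, w m = v → complexify (e y) (ψ y) w = 0) (w : Fin (k + 1) → n → ℂ) :
    complexify (e x) (extDeriv ψ x) (Matrix.vecCons v w)
      = complexifyFunctional (e x) (fderiv ℝ (fun y => complexify (e y) (ψ y) w) x) v
        - ∑ m, (-1) ^ m.val * complexify (e x) (ψ x)
          (Matrix.vecCons (frameBracket e x v (w m)) (m.removeNth w)) := by
  have remove_zero : Fin.removeNth (0 : Fin (k + 2)) (Matrix.vecCons v w) = w := rfl
  have deriv_term : ∀ i : Fin (k + 1), complexifyFunctional (e x) (fderiv ℝ (fun y =>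
      complexify (e y) (ψ y) (i.succ.removeNth (Matrix.vecCons v w))) x) (w i) = 0 := by
    intro i
    have : ∀ y, complexify (e y) (ψ y) (i.succ.removeNth (Matrix.vecCons v w)) = 0 :=
      fun y => hv y _ 0 (by simp [Fin.removeNth])
    simp [this, complexifyFunctional_apply]
  have bracket_term : ∀ (i : Fin k) (u : n → ℂ), ∀ j ≥ i.succ, complexify (e x) (ψ x)
      (Matrix.vecCons u (j.removeNth (i.succ.castSucc.removeNth (Matrix.vecCons v w)))) = 0 := by
    intro i u j hj
    obtain ⟨k, rfl⟩ : ∃ k', k = k' + 1 := Nat.exists_eq_add_one_of_ne_zero (by have := i.2; omega)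
    have hj0 : j ≠ 0 := Fin.pos_iff_ne_zero.mp ((Fin.succ_pos i).trans_le hj)
    refine hv x _ 1 ?_
    change (j.removeNth (i.succ.castSucc.removeNth (Matrix.vecCons v w))) 0 = v
    simp only [Fin.removeNth, Fin.succAbove_ne_zero_zero hj0,
      Fin.succAbove_ne_zero_zero (Fin.castSucc_ne_zero_iff.mpr (Fin.succ_ne_zero i))]
    rfl
  rw [complexify_extDeriv he hψ, Fin.sum_univ_succ]
  simp only [remove_zero, Matrix.cons_val_zero, Matrix.cons_val_succ, deriv_term, mul_zero,
    Finset.sum_const_zero, add_zero, Fin.val_zero, pow_zero, one_mul]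
  rw [Fin.sum_univ_succ, Finset.sum_eq_zero (s := Finset.univ) fun i _ =>
    Finset.sum_eq_zero fun j hj => by rw [bracket_term i _ j (Finset.mem_Ici.mp hj), mul_zero],
    add_zero]
  simp [show Finset.Ici (0 : Fin (k + 1)) = Finset.univ by ext; simp, remove_zero]

end Cartan

section Frame

/-- The left-invariant frame `e₁, …, e₆` at `x`, as a basis of the tangent space. -/
def frameBasis (x : E) : Module.Basis (Fin 6) ℝ E :=
  Module.Basis.ofEquivFun
    { toFun := fun v i => coframe x i v
      map_add' := fun v w => by ext; simp
      map_smul' := fun r v => by ext; simp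
      invFun := fun u => ∑ i, u i • frame x i
      left_inv := sum_coframe_smul_frame x
      right_inv := fun u => by ext i; simp [coframe_frame] }

theorem frameBasis_apply (x : E) (i : Fin 6) : frameBasis x i = frame x i := by
  simp [frameBasis, Module.Basis.coe_ofEquivFun, Pi.single_apply]

theorem frameBasis_repr (x v : E) (i : Fin 6) : (frameBasis x).repr v i = coframe x i v := rfl

/-- The exponents `k` such that `e_i` grows like `e^{k t}`. -/
def weight : Fin 6 → ℝ := ![0, 0, 1, -1, 1, -1]

/-- The derivatives of the frame fields in the direction `e₂` at the identity. -/
def shear : Fin 6 → E := ![0, 0, 0, 0, Pi.single 2 1, Pi.single 3 1]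

theorem frame_eq_exp_smul (x : E) (i : Fin 6) :
    frame x i = Real.exp (weight i * x 0) • (Pi.single i 1 + x 1 • shear i) := by
  ext j
  fin_cases i <;> fin_cases j <;> simp [frame, weight, shear, mul_comm]

theorem differentiableAt_frameBasis (x : E) (i : Fin 6) :
    DifferentiableAt ℝ (fun y => frameBasis y i) x := by
  simp only [frameBasis_apply, frame_eq_exp_smul]
  fun_prop

theorem fderiv_frame_apply (x v : E) (i : Fin 6) :
    fderiv ℝ (fun y => frame y i) x v = (v 0 * weight i) • frame x i
      + v 1 • (![0, 0, 0, 0, frame x 2, frame x 3] : Fin 6 → E) i := by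
  have exponent : HasFDerivAt (fun y : E => weight i * y 0)
      (weight i • (ContinuousLinearMap.proj 0 : E →L[ℝ] ℝ)) x :=
    (hasFDerivAt_apply 0 x).const_mul _
  have affine : HasFDerivAt (fun y : E => Pi.single i 1 + y 1 • shear i)
      ((ContinuousLinearMap.proj 1 : E →L[ℝ] ℝ).smulRight (shear i)) x :=
    ((hasFDerivAt_apply 1 x).smul_const _).const_add _
  have transported : (![0, 0, 0, 0, frame x 2, frame x 3] : Fin 6 → E) i
      = Real.exp (weight i * x 0) • shear i := by
    fin_cases i <;> simp [frame_eq_exp_smul, weight, shear]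
  rw [transported, frame_eq_exp_smul x i, funext fun y => frame_eq_exp_smul y i,
    (exponent.exp.fun_smul affine).fderiv]
  simp only [add_apply, smul_apply, ContinuousLinearMap.smulRight_apply,
    ContinuousLinearMap.proj_apply, smul_eq_mul]
  module

theorem lieBracket_frame (x : E) (i j : Fin 6) :
    VectorField.lieBracket ℝ (fun y => frame y i) (fun y => frame y j) x
      = (if i = 0 then weight j • frame x j else 0) - (if j = 0 then weight i • frame x i else 0)
        + ((if i = 1 then (![0, 0, 0, 0, frame x 2, frame x 3] : Fin 6 → E) j else 0)
          - if j = 1 then (![0, 0, 0, 0, frame x 2, frame x 3] : Fin 6 → E) i else 0) := by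
  have apply_zero : ∀ i, frame x i 0 = if i = 0 then 1 else 0 := fun i => by
    fin_cases i <;> simp [frame]
  have apply_one : ∀ i, frame x i 1 = if i = 1 then 1 else 0 := fun i => by
    fin_cases i <;> simp [frame]
  rw [VectorField.lieBracket, fderiv_frame_apply, fderiv_frame_apply, apply_zero, apply_one,
    apply_zero, apply_one]
  split_ifs <;> module

theorem frameBracket_frameBasis (x : E) (v w : Fin 6 → ℂ) :
    frameBracket frameBasis x v w
      = ![0, 0, v 0 * w 2 - w 0 * v 2 + (v 1 * w 4 - w 1 * v 4),
        -(v 0 * w 3 - w 0 * v 3) + (v 1 * w 5 - w 1 * v 5),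
        v 0 * w 4 - w 0 * v 4, -(v 0 * w 5 - w 0 * v 5)] := by
  ext l
  simp only [frameBracket, frameBasis_apply, frameBasis_repr, lieBracket_frame, Finset.sum_apply,
    Fin.sum_univ_six]
  fin_cases l <;> simp [coframe_frame, weight] <;> ring

theorem complexifyEnd_J (a b c : ℝ) (x : E) (v : Fin 6 → ℂ) :
    complexifyEnd (frameBasis x) (J a b c x) v
      = ![-(1 / a) * v 1, a * v 0, -b * v 3 - 1 / c * v 5, -(1 / c) * v 4, c * v 3,
        c * v 2 + b * v 4] := by
  ext l
  rw [complexifyEnd_apply, Fin.sum_univ_six]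
  fin_cases l <;> simp [frameBasis_apply, frameBasis_repr, J_frame, coframe_frame] <;> ring

end Frame

section HolomorphicFrame

/-- The left-invariant complex vector fields `Z_j = (e - i J e) / 2`, for `e = e₁ / a, e₃, e₄`,
which span the tangent vectors of type `(1,0)`; in coordinates with respect to the frame. -/
def Z (a b c : ℝ) : Fin 3 → Fin 6 → ℂ :=
  ![![1 / (2 * a), -Complex.I / 2, 0, 0, 0, 0],
    ![0, 0, 1 / 2, 0, 0, -Complex.I * c / 2],
    ![0, 0, Complex.I * b / 2, 1 / 2, -Complex.I * c / 2, 0]]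

/-- The complex conjugates of the vector fields `Z_j`, of type `(0,1)`. -/
def Zbar (a b c : ℝ) : Fin 3 → Fin 6 → ℂ := star (Z a b c)

theorem Zbar_eq (a b c : ℝ) :
    Zbar a b c = (![![1 / (2 * a), Complex.I / 2, 0, 0, 0, 0],
      ![0, 0, 1 / 2, 0, 0, Complex.I * c / 2],
      ![0, 0, -Complex.I * b / 2, 1 / 2, Complex.I * c / 2, 0]] : Fin 3 → Fin 6 → ℂ) := by
  ext j i
  fin_cases j <;> fin_cases i <;> simp [Zbar, Z]

variable {a b c : ℝ}

theorem complexifyEnd_J_Z (ha : a ≠ 0) (hc : c ≠ 0) (x : E) (j : Fin 3) :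
    complexifyEnd (frameBasis x) (J a b c x) (Z a b c j) = Complex.I • Z a b c j := by
  have ha' : (a : ℂ) ≠ 0 := by exact_mod_cast ha
  have hc' : (c : ℂ) ≠ 0 := by exact_mod_cast hc
  rw [complexifyEnd_J]
  ext i
  fin_cases j <;> fin_cases i <;> simp [Z] <;> field_simp <;> simp

theorem complexifyEnd_J_Zbar (ha : a ≠ 0) (hc : c ≠ 0) (x : E) (j : Fin 3) :
    complexifyEnd (frameBasis x) (J a b c x) (Zbar a b c j) = -Complex.I • Zbar a b c j := by
  have ha' : (a : ℂ) ≠ 0 := by exact_mod_cast ha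
  have hc' : (c : ℂ) ≠ 0 := by exact_mod_cast hc
  rw [complexifyEnd_J, Zbar_eq]
  ext i
  fin_cases j <;> fin_cases i <;> simp <;> field_simp <;> simp

theorem eq_sum_smul_Z_add_sum_smul_Zbar (ha : a ≠ 0) (hc : c ≠ 0) (v : Fin 6 → ℂ) :
    v = ∑ j, (![a * v 0 + Complex.I * v 1, v 2 + b / c * v 4 + Complex.I / c * v 5,
        v 3 + Complex.I / c * v 4] : Fin 3 → ℂ) j • Z a b c j
      + ∑ j, (![a * v 0 - Complex.I * v 1, v 2 + b / c * v 4 - Complex.I / c * v 5,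
        v 3 - Complex.I / c * v 4] : Fin 3 → ℂ) j • Zbar a b c j := by
  have ha' : (a : ℂ) ≠ 0 := by exact_mod_cast ha
  have hc' : (c : ℂ) ≠ 0 := by exact_mod_cast hc
  have hI : Complex.I ^ 2 = -1 := Complex.I_sq
  rw [Zbar_eq]
  ext i
  fin_cases i <;> simp [Fin.sum_univ_three, Z] <;> field_simp <;> ring_nf <;>
    simp only [hI] <;> ring

theorem span_Z_Zbar (ha : a ≠ 0) (hc : c ≠ 0) :
    ⊤ ≤ Submodule.span ℂ (Set.range (Sum.elim (Z a b c) (Zbar a b c))) := by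
  intro v _
  rw [eq_sum_smul_Z_add_sum_smul_Zbar (b := b) ha hc v]
  refine add_mem (sum_mem fun j _ => ?_) (sum_mem fun j _ => ?_)
  · exact Submodule.smul_mem _ _ (Submodule.subset_span ⟨Sum.inl j, rfl⟩)
  · exact Submodule.smul_mem _ _ (Submodule.subset_span ⟨Sum.inr j, rfl⟩)

/-- The basis `Z₁, Z₂, Z₃, Z̄₁, Z̄₂, Z̄₃` of the complexified tangent space. -/
def typeBasis (b : ℝ) (ha : a ≠ 0) (hc : c ≠ 0) : Module.Basis (Fin 3 ⊕ Fin 3) ℂ (Fin 6 → ℂ) :=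
  basisOfTopLeSpanOfCardEqFinrank (Sum.elim (Z a b c) (Zbar a b c)) (span_Z_Zbar ha hc) (by simp)

theorem coe_typeBasis (ha : a ≠ 0) (hc : c ≠ 0) :
    ⇑(typeBasis b ha hc) = Sum.elim (Z a b c) (Zbar a b c) :=
  coe_basisOfTopLeSpanOfCardEqFinrank _ _ _

/-- The coefficients of the `(1,0)`-part of the brackets `[Z̄_j, Z_i]`. -/
def structZ (a c : ℝ) : Fin 3 → Fin 3 → Fin 3 → ℂ :=
  ![![![0, 0, 0], ![0, 0, c / 4], ![0, c / 4, 0]],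
    ![![0, -1 / (2 * a), -c / 4], ![0, 0, 0], ![0, 0, 0]],
    ![![0, -c / 4, 1 / (2 * a)], ![0, 0, 0], ![0, 0, 0]]]

/-- The coefficients of the `(0,1)`-part of the brackets `[Z̄_j, Z_i]`. -/
def structZbar (a c : ℝ) : Fin 3 → Fin 3 → Fin 3 → ℂ :=
  ![![![0, 0, 0], ![0, 1 / (2 * a), c / 4], ![0, c / 4, -1 / (2 * a)]],
    ![![0, 0, -c / 4], ![0, 0, 0], ![0, 0, 0]],
    ![![0, -c / 4, 0], ![0, 0, 0], ![0, 0, 0]]]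

theorem frameBracket_Zbar_Z (ha : a ≠ 0) (b c : ℝ) (x : E) (j i : Fin 3) :
    frameBracket frameBasis x (Zbar a b c j) (Z a b c i)
      = ∑ l, structZ a c j i l • Z a b c l + ∑ l, structZbar a c j i l • Zbar a b c l := by
  have ha' : (a : ℂ) ≠ 0 := by exact_mod_cast ha
  have hI : Complex.I ^ 2 = -1 := Complex.I_sq
  rw [frameBracket_frameBasis, Zbar_eq]
  ext r
  simp only [Fin.sum_univ_three]
  fin_cases j <;> fin_cases i <;> fin_cases r <;>
    simp [Z, structZ, structZbar] <;> field_simp <;> ring_nf <;> simp only [hI] <;> ring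

end HolomorphicFrame

section DbarEquation

theorem eq_zero_of_forall_strictMono {R M N ι : Type*} [CommRing R] [AddCommGroup M] [Module R M]
    [AddCommGroup N] [Module R N] [LinearOrder ι] {k : ℕ} {f : M [⋀^Fin k]→ₗ[R] N} {u : ι → M}
    (h : ∀ I : Fin k → ι, StrictMono I → f (u ∘ I) = 0) (I : Fin k → ι) : f (u ∘ I) = 0 := by
  by_cases hI : Function.Injective I
  · have hperm := f.map_perm (u ∘ I) (Tuple.sort I)
    rw [Function.comp_assoc, h _ ((Tuple.monotone_sort I).strictMono_of_injective
      (hI.comp (Tuple.sort I).injective))] at hperm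
    exact (smul_eq_zero_iff_eq _).mp hperm.symm
  · obtain ⟨i, j, hij, hne⟩ := Function.not_injective_iff.mp hI
    exact f.map_eq_zero_of_eq _ (congrArg u hij) hne

/-- The derivative of a function along a complex combination, with constant coefficients, of the
vector fields of the frame. -/
def cderiv (v : Fin 6 → ℂ) (f : E → ℂ) (x : E) : ℂ :=
  complexifyFunctional (frameBasis x) (fderiv ℝ f x) v

/-- The coefficients of a form of type `(p,0)` in the coframe dual to `Z₁, Z₂, Z₃`. -/
def coef (a b c : ℝ) {k : ℕ} (ψ : Form k) (I : Fin k → Fin 3) (y : E) : ℂ :=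
  complexify (frameBasis y) (ψ y) (Z a b c ∘ I)

variable {a b c : ℝ} {k : ℕ} {x : E}

theorem eq_zero_of_coef_eq_zero (ha : a ≠ 0) (hc : c ≠ 0) {ψ : Form k}
    (hψ : ψ x ∈ bigraded (J a b c x) k k 0)
    (h : ∀ I : Fin k → Fin 3, StrictMono I → coef a b c ψ I x = 0) : ψ x = 0 := by
  refine eq_zero_of_mem_bigraded (frameBasis x) (B := typeBasis b ha hc) (fun i => ?_) hψ
    fun I => ?_
  · simpa only [coe_typeBasis, Sum.elim_inr] using complexifyEnd_J_Zbar ha hc x i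
  · rw [coe_typeBasis, ← Function.comp_assoc, Sum.elim_comp_inl]
    exact eq_zero_of_forall_strictMono h I

theorem typeProj_J_one_eq_zero_iff (ha : a ≠ 0) (hc : c ≠ 0) (α : E [⋀^Fin (k + 1)]→L[ℝ] ℂ) :
    typeProj (J a b c x) k 1 α = 0 ↔ ∀ (j : Fin 3) (I : Fin k → Fin 3), StrictMono I →
      complexify (frameBasis x) α (Matrix.vecCons (Zbar a b c j) (Z a b c ∘ I)) = 0 := by
  have comp_vecCons : ∀ j (I : Fin k → Fin 3), typeBasis b ha hc ∘
      Matrix.vecCons (Sum.inr j) (Sum.inl ∘ I) = Matrix.vecCons (Zbar a b c j) (Z a b c ∘ I) := by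
    intro j I
    rw [coe_typeBasis, Matrix.vecCons, Fin.comp_cons]
    rfl
  rw [typeProj_one_eq_zero_iff (frameBasis x) (B := typeBasis b ha hc)
    (by simpa only [coe_typeBasis, Sum.elim_inl] using complexifyEnd_J_Z ha hc x)
    (by simpa only [coe_typeBasis, Sum.elim_inr] using complexifyEnd_J_Zbar ha hc x)]
  simp only [comp_vecCons]
  refine forall_congr' fun j => ⟨fun h I _ => h I, fun h => ?_⟩
  exact eq_zero_of_forall_strictMono (f := (complexify (frameBasis x) α).curryLeft (Zbar a b c j)) h

theorem complexify_vecCons_frameBracket_Zbar_Z (ha : a ≠ 0) (hc : c ≠ 0) {ψ : Form (k + 1)}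
    (hψ : ψ x ∈ bigraded (J a b c x) (k + 1) (k + 1) 0) (j i : Fin 3) (I : Fin k → Fin 3) :
    complexify (frameBasis x) (ψ x) (Matrix.vecCons
        (frameBracket frameBasis x (Zbar a b c j) (Z a b c i)) (Z a b c ∘ I))
      = ∑ l, structZ a c j i l * coef a b c ψ (Matrix.vecCons l I) x := by
  have antiholomorphic : ∀ l, complexify (frameBasis x) (ψ x)
      (Matrix.vecCons (Zbar a b c l) (Z a b c ∘ I)) = 0 := fun l =>
    complexify_eq_zero_of_mem_bigraded (frameBasis x) hψ (m := 0) (complexifyEnd_J_Zbar ha hc x l)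
  have coef_vecCons : ∀ l, coef a b c ψ (Matrix.vecCons l I) x
      = complexify (frameBasis x) (ψ x) (Matrix.vecCons (Z a b c l) (Z a b c ∘ I)) := fun l => by
    rw [coef, Matrix.vecCons, Fin.comp_cons]
    rfl
  change (complexify (frameBasis x) (ψ x)).toMultilinearMap.curryLeft _ (Z a b c ∘ I) = _
  simp only [frameBracket_Zbar_Z ha, map_add, map_sum, map_smul, add_apply, sum_apply, smul_apply]
  change ∑ l, structZ a c j i l • complexify (frameBasis x) (ψ x)
      (Matrix.vecCons (Z a b c l) (Z a b c ∘ I))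
    + ∑ l, structZbar a c j i l • complexify (frameBasis x) (ψ x)
      (Matrix.vecCons (Zbar a b c l) (Z a b c ∘ I)) = _
  simp [antiholomorphic, coef_vecCons]

theorem dbar_eq_zero_iff (ha : a ≠ 0) (hc : c ≠ 0) {ψ : Form (k + 1)}
    (hψ : DifferentiableAt ℝ ψ x) (hJ : ∀ y, ψ y ∈ bigraded (J a b c y) (k + 1) (k + 1) 0) :
    dbar a b c (k + 1) 0 ψ x = 0 ↔ ∀ (j : Fin 3) (I : Fin (k + 1) → Fin 3), StrictMono I →
      cderiv (Zbar a b c j) (coef a b c ψ I) x = ∑ m : Fin (k + 1), (-1) ^ (m : ℕ) *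
        ∑ l, structZ a c j (I m) l * coef a b c ψ (Matrix.vecCons l (m.removeNth I)) x := by
  refine (typeProj_J_one_eq_zero_iff (k := k + 1) ha hc (extDeriv ψ x)).trans ?_
  refine forall_congr' fun j => forall_congr' fun I => forall_congr' fun _ => ?_
  have antiholomorphic : ∀ y w m, w m = Zbar a b c j →
      complexify (frameBasis y) (ψ y) w = 0 := fun y w m hw =>
    complexify_eq_zero_of_mem_bigraded (frameBasis y) (hJ y) (m := m)
      (by rw [hw, complexifyEnd_J_Zbar ha hc])
  rw [complexify_extDeriv_vecCons (differentiableAt_frameBasis x) hψ antiholomorphic, sub_eq_zero]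
  simp only [← complexify_vecCons_frameBracket_Zbar_Z ha hc (hJ x)]
  rfl

end DbarEquation

section Liouville

variable {F : Type*} [NormedAddCommGroup F] [NormedSpace ℂ F]

/-- The increments of a bounded function with constant `∂/∂z̄` are holomorphic and bounded, hence
constant, and they are additive in the increment, hence zero. -/
theorem apply_eq_apply_of_bounded_of_cauchyRiemann_eq_const {h : ℂ → F} (hd : Differentiable ℝ h)
    (hb : Bornology.IsBounded (Set.range h)) {C : F}
    (hC : ∀ z, fderiv ℝ h z 1 + Complex.I • fderiv ℝ h z Complex.I = C) (z w : ℂ) :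
    h z = h w := by
  obtain ⟨M, hM⟩ := hb.exists_norm_le
  replace hM : ∀ z, ‖h z‖ ≤ M := fun z => hM _ ⟨z, rfl⟩
  have increment_const : ∀ s z w, h (z + s) - h z = h (w + s) - h w := by
    intro s
    refine Differentiable.apply_eq_apply_of_bounded (f := fun z => h (z + s) - h z) (fun z => ?_)
      ((Metric.isBounded_closedBall (x := (0 : F)) (r := M + M)).subset
        (Set.range_subset_iff.mpr fun z => ?_))
    · have hderiv := ((hasFDerivAt_comp_add_right s).mpr (hd (z + s)).hasFDerivAt).fun_sub
        (hd z).hasFDerivAt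
      rw [differentiableAt_complex_iff_differentiableAt_real]
      refine ⟨hderiv.differentiableAt, ?_⟩
      have hsub : fderiv ℝ h (z + s) 1 + Complex.I • fderiv ℝ h (z + s) Complex.I
          - (fderiv ℝ h z 1 + Complex.I • fderiv ℝ h z Complex.I) = 0 := by rw [hC, hC, sub_self]
      rw [hderiv.fderiv, sub_apply, sub_apply, ← sub_eq_zero, ← smul_zero (-Complex.I), ← hsub]
      simp only [smul_add, smul_sub, smul_smul, neg_mul, Complex.I_mul_I]
      module
    · simpa using (norm_sub_le _ _).trans (add_le_add (hM (z + s)) (hM z))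
  set s := z - w with hs
  have multiple : ∀ n : ℕ, h (w + n • s) - h w = n • (h z - h w) := by
    intro n
    induction n with
    | zero => simp
    | succ n ih =>
      have := increment_const s (w + n • s) w
      rw [hs, add_sub_cancel, ← hs] at this
      rw [succ_nsmul, succ_nsmul, ← ih, ← this, ← add_assoc]
      abel
  by_contra hne
  obtain ⟨n, hn⟩ := exists_nat_gt ((M + M) / ‖h z - h w‖)
  rw [div_lt_iff₀ (norm_pos_iff.mpr (sub_ne_zero.mpr hne))] at hn
  have hle := (norm_sub_le _ _).trans (add_le_add (hM (w + n • s)) (hM w))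
  rw [multiple, ← Nat.cast_smul_eq_nsmul ℝ, norm_smul, Real.norm_natCast] at hle
  exact hn.not_ge hle

theorem eq_zero_and_const_on_plane {V : Type*} [NormedAddCommGroup V] [NormedSpace ℝ V] {f : V → F}
    (hf : Differentiable ℝ f) (hb : Bornology.IsBounded (Set.range f)) {p u v : V} {C : F}
    (hC : ∀ s t : ℝ, fderiv ℝ f (p + s • u + t • v) u
      + Complex.I • fderiv ℝ f (p + s • u + t • v) v = C) :
    C = 0 ∧ ∀ s t : ℝ, f (p + s • u + t • v) = f p := by
  let plane : ℂ → V := fun z => p + z.re • u + z.im • v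
  have plane_deriv : ∀ z, HasFDerivAt plane
      (Complex.reCLM.smulRight u + Complex.imCLM.smulRight v) z := fun z =>
    ((Complex.reCLM.smulRight u).hasFDerivAt.const_add p).add
      (Complex.imCLM.smulRight v).hasFDerivAt
  have hderiv : ∀ z, HasFDerivAt (f ∘ plane) ((fderiv ℝ f (plane z)).comp
      (Complex.reCLM.smulRight u + Complex.imCLM.smulRight v)) z := fun z =>
    (hf (plane z)).hasFDerivAt.comp z (plane_deriv z)
  have hcr : ∀ z, fderiv ℝ (f ∘ plane) z 1
      + Complex.I • fderiv ℝ (f ∘ plane) z Complex.I = C := fun z => by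
    rw [(hderiv z).fderiv]
    simpa using hC z.re z.im
  have hconst := apply_eq_apply_of_bounded_of_cauchyRiemann_eq_const
    (fun z => (hderiv z).differentiableAt) (hb.subset (Set.range_comp_subset_range _ _)) hcr
  refine ⟨?_, fun s t => by simpa [plane] using hconst ⟨s, t⟩ 0⟩
  rw [← hcr 0, show f ∘ plane = fun _ => f (plane 0) from funext fun z => hconst z 0]
  simp

end Liouville

section LatticeInvariance

/-- The linear part of the left translation by `g`, which is an affine map in the coordinates. -/
def leftLin (g : E) : E →L[ℝ] E :=
  LinearMap.toContinuousLinearMap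
    { toFun := fun v => ![v 0, v 1,
        v 2 * Real.exp (g 0) + g 1 * v 4 * Real.exp (g 0),
        v 3 * Real.exp (-g 0) + g 1 * v 5 * Real.exp (-g 0),
        v 4 * Real.exp (g 0), v 5 * Real.exp (-g 0)]
      map_add' := fun v w => by
        ext i
        fin_cases i <;> simp <;> ring
      map_smul' := fun r v => by
        ext i
        fin_cases i <;> simp <;> ring }

theorem leftLin_apply (g v : E) : leftLin g v = ![v 0, v 1,
    v 2 * Real.exp (g 0) + g 1 * v 4 * Real.exp (g 0),
    v 3 * Real.exp (-g 0) + g 1 * v 5 * Real.exp (-g 0),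
    v 4 * Real.exp (g 0), v 5 * Real.exp (-g 0)] := rfl

theorem leftTrans_eq_leftLin_add (γ : G) :
    leftTrans γ = fun x => leftLin γ.coords x + γ.coords := by
  funext x
  ext i
  fin_cases i <;> simp [leftTrans, gmul, leftLin_apply] <;> ring

theorem contDiff_leftTrans (γ : G) : ContDiff ℝ ∞ (leftTrans γ) := by
  rw [leftTrans_eq_leftLin_add]
  exact (leftLin γ.coords).contDiff.add contDiff_const

theorem fderiv_leftTrans (γ : G) (x : E) : fderiv ℝ (leftTrans γ) x = leftLin γ.coords := by
  rw [leftTrans_eq_leftLin_add, fderiv_add_const, ContinuousLinearMap.fderiv]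

theorem fderiv_leftTrans_frame (γ : G) (x : E) (i : Fin 6) :
    fderiv ℝ (leftTrans γ) x (frame x i) = frame (leftTrans γ x) i := by
  rw [fderiv_leftTrans]
  ext j
  fin_cases i <;> fin_cases j <;>
    simp [leftLin_apply, frame, leftTrans, gmul, Real.exp_add] <;> ring

/-- The functions on `G` which descend to the quotient by the lattice. -/
def IsLatticeInvariant (D : LatticeData) (f : E → ℂ) : Prop :=
  ∀ γ ∈ D.lattice, ∀ x, f (leftTrans γ x) = f x

variable {D : LatticeData}

theorem IsLatticeInvariant.isBounded_range {f : E → ℂ} (h : IsLatticeInvariant D f)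
    (hf : Continuous f) : Bornology.IsBounded (Set.range f) := by
  obtain ⟨K, hK, hDK⟩ := D.exists_isCompact_fundDomain
  refine (hK.image hf).isBounded.subset (Set.range_subset_iff.mpr fun x => ?_)
  obtain ⟨γ, ⟨hγ, hx⟩, -⟩ := D.existsUnique_mem_fundDomain x
  exact ⟨_, hDK hx, h γ hγ x⟩

variable {a b c : ℝ} {p q : ℕ} {ψ : Form (p + q)}

theorem isLatticeInvariant_coef (hψ : ψ ∈ forms D a b c p q) (I : Fin (p + q) → Fin 3) :
    IsLatticeInvariant D (coef a b c ψ I) := by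
  intro γ hγ x
  have invariance : ∀ K : Fin (p + q) → Fin 6,
      ψ (leftTrans γ x) (frame (leftTrans γ x) ∘ K) = ψ x (frame x ∘ K) := fun K => by
    rw [← hψ.2.1 γ hγ x, show frame (leftTrans γ x) = fderiv ℝ (leftTrans γ) x ∘ frame x from
      funext fun i => (fderiv_leftTrans_frame γ x i).symm]
    rfl
  simp only [coef, complexify_apply, funext (frameBasis_apply _), invariance]

theorem differentiable_coef {k : ℕ} {ψ : Form k} (hψ : Differentiable ℝ ψ) (I : Fin k → Fin 3) :
    Differentiable ℝ (coef a b c ψ I) := by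
  intro x
  unfold coef
  simp only [complexify_apply]
  exact DifferentiableAt.fun_sum fun K _ => ((hψ x).continuousAlternatingMap_apply fun m =>
    differentiableAt_frameBasis x (K m)).mul_const _

theorem isBounded_range_coef (hψ : ψ ∈ forms D a b c p q) (I : Fin (p + q) → Fin 3) :
    Bornology.IsBounded (Set.range (coef a b c ψ I)) :=
  (isLatticeInvariant_coef hψ I).isBounded_range
    (differentiable_coef (hψ.1.differentiable (by simp)) I).continuous

end LatticeInvariance

section CauchyRiemann

variable {f g : E → ℂ} {x : E}

theorem cderiv_const (v : Fin 6 → ℂ) (r : ℂ) (x : E) : cderiv v (fun _ => r) x = 0 := by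
  simp [cderiv, complexifyFunctional_apply]

theorem cderiv_add (hf : DifferentiableAt ℝ f x) (hg : DifferentiableAt ℝ g x) (v : Fin 6 → ℂ) :
    cderiv v (f + g) x = cderiv v f x + cderiv v g x := by
  simp only [cderiv, complexifyFunctional_apply, fderiv_add hf hg, add_apply, mul_add,
    Finset.sum_add_distrib]

theorem cderiv_mul (hf : DifferentiableAt ℝ f x) (hg : DifferentiableAt ℝ g x) (v : Fin 6 → ℂ) :
    cderiv v (f * g) x = f x * cderiv v g x + g x * cderiv v f x := by
  simp only [cderiv, complexifyFunctional_apply, fderiv_mul hf hg, add_apply, smul_apply,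
    smul_eq_mul, Finset.mul_sum, ← Finset.sum_add_distrib]
  exact Finset.sum_congr rfl fun i _ => by ring

theorem cderiv_smul (hf : DifferentiableAt ℝ f x) (r : ℂ) (v : Fin 6 → ℂ) :
    cderiv v (r • f) x = r * cderiv v f x := by
  simp only [cderiv, complexifyFunctional_apply, fderiv_const_smul hf, smul_apply,
    smul_eq_mul, Finset.mul_sum]
  exact Finset.sum_congr rfl fun i _ => by ring

/-- The left-invariant vector fields `u_j = e₁ / a, e₃, e₄`, for which `Z̄_j = (u_j + i J u_j) / 2`
is the Cauchy–Riemann operator of the plane spanned by `u_j` and `J u_j`. -/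
def realFrame (a : ℝ) (x : E) : Fin 3 → E :=
  ![(1 / a) • frame x 0, frame x 2, frame x 3]

variable {a b c : ℝ}

theorem J_realFrame (ha : a ≠ 0) (b c : ℝ) (x : E) (j : Fin 3) :
    J a b c x (realFrame a x j)
      = (![frame x 1, c • frame x 5, c • frame x 4 - b • frame x 2] : Fin 3 → E) j := by
  fin_cases j <;> simp [realFrame, J_frame, smul_smul, ha]

theorem cderiv_Zbar (ha : a ≠ 0) (b c : ℝ) (f : E → ℂ) (x : E) (j : Fin 3) :
    cderiv (Zbar a b c j) f x = (fderiv ℝ f x (realFrame a x j)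
      + Complex.I * fderiv ℝ f x (J a b c x (realFrame a x j))) / 2 := by
  rw [J_realFrame ha, cderiv, complexifyFunctional_apply, Zbar_eq]
  fin_cases j <;> simp [Fin.sum_univ_six, frameBasis_apply, realFrame] <;> ring

/-- The point with parameters `(s, t)` of the affine plane through `p` spanned by `u_j` and `J u_j`,
which is an integral surface of these two vector fields. -/
def complexLine (a b c : ℝ) (p : E) (j : Fin 3) (s t : ℝ) : E :=
  p + s • realFrame a p j + t • J a b c p (realFrame a p j)

theorem complexLine_apply_zero (ha : a ≠ 0) (b c : ℝ) (p : E) (j : Fin 3) (s t : ℝ) :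
    complexLine a b c p j s t 0 = if j = 0 then p 0 + s / a else p 0 := by
  rw [complexLine, J_realFrame ha, Pi.add_apply, Pi.add_apply]
  fin_cases j <;> simp [realFrame, frame, div_eq_mul_inv]

theorem complexLine_apply_one (ha : a ≠ 0) (b c : ℝ) (p : E) (j : Fin 3) (s t : ℝ) :
    complexLine a b c p j s t 1 = if j = 0 then p 1 + t else p 1 := by
  rw [complexLine, J_realFrame ha, Pi.add_apply, Pi.add_apply]
  fin_cases j <;> simp [realFrame, frame]

theorem frame_congr {p q : E} (h0 : q 0 = p 0) (h1 : q 1 = p 1) : frame q = frame p := by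
  simp only [frame, h0, h1]

theorem cderiv_Zbar_complexLine (ha : a ≠ 0) (b c : ℝ) (f : E → ℂ) (p : E) (j : Fin 3) (s t : ℝ) :
    cderiv (Zbar a b c j) f (complexLine a b c p j s t)
      = (fderiv ℝ f (complexLine a b c p j s t) (realFrame a p j) + Complex.I *
        fderiv ℝ f (complexLine a b c p j s t) (J a b c p (realFrame a p j))) / 2 := by
  set q := complexLine a b c p j s t with hq
  have frame_eq : j = 0 ∨ frame q = frame p := by
    refine or_iff_not_imp_left.mpr fun hj => frame_congr ?_ ?_
    · rw [hq, complexLine_apply_zero ha, if_neg hj]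
    · rw [hq, complexLine_apply_one ha, if_neg hj]
  rw [cderiv_Zbar ha, J_realFrame ha, J_realFrame ha, realFrame, realFrame]
  obtain rfl | frame_eq := frame_eq
  · simp only [Matrix.cons_val_zero, Matrix.cons_val_one, frame]
  · rw [frame_eq]

theorem eq_zero_and_const_of_cderiv_Zbar_eq (ha : a ≠ 0) (hf : Differentiable ℝ f)
    (hb : Bornology.IsBounded (Set.range f)) {p : E} {j : Fin 3} {C : ℂ}
    (hC : ∀ s t, cderiv (Zbar a b c j) f (complexLine a b c p j s t) = C) :
    C = 0 ∧ ∀ s t, f (complexLine a b c p j s t) = f p := by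
  obtain ⟨hzero, hconst⟩ := eq_zero_and_const_on_plane hf hb (p := p) (C := 2 * C)
    (u := realFrame a p j) (v := J a b c p (realFrame a p j)) fun s t => by
      rw [← hC s t, cderiv_Zbar_complexLine ha, complexLine, smul_eq_mul]
      ring
  exact ⟨by simpa using hzero, hconst⟩

theorem eq_zero_of_cderiv_Zbar_eq_on_fibre (ha : a ≠ 0) (hf : Differentiable ℝ f)
    (hb : Bornology.IsBounded (Set.range f)) {p : E} {j : Fin 3} (hj : j ≠ 0) {C : ℂ}
    (hC : ∀ q : E, q 0 = p 0 → q 1 = p 1 → cderiv (Zbar a b c j) f q = C) : C = 0 :=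
  (eq_zero_and_const_of_cderiv_Zbar_eq ha hf hb fun s t => hC _
    (by rw [complexLine_apply_zero ha, if_neg hj]) (by rw [complexLine_apply_one ha, if_neg hj])).1

theorem exists_eq_complexLine_complexLine (ha : a ≠ 0) (b : ℝ) (hc : c ≠ 0) {p q : E}
    (h0 : q 0 = p 0) (h1 : q 1 = p 1) :
    ∃ s t s' t', q = complexLine a b c (complexLine a b c p 1 s t) 2 s' t' := by
  set κ : Fin 6 → ℝ := fun i => coframe p i (q - p) with hκ
  refine ⟨κ 2 + b * κ 4 / c, κ 5 / c, κ 3, κ 4 / c, ?_⟩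
  have frame_eq : frame (complexLine a b c p 1 (κ 2 + b * κ 4 / c) (κ 5 / c)) = frame p :=
    frame_congr (by rw [complexLine_apply_zero ha]; rfl) (by rw [complexLine_apply_one ha]; rfl)
  have expansion : q = p + ∑ i, κ i • frame p i := by
    rw [hκ, sum_coframe_smul_frame, add_sub_cancel]
  have hκ0 : κ 0 = 0 := by simp [hκ, coframe, h0]
  have hκ1 : κ 1 = 0 := by simp [hκ, coframe, h1]
  rw [complexLine, J_realFrame ha, realFrame, frame_eq, complexLine, J_realFrame ha, realFrame]
  conv_lhs => rw [expansion, Fin.sum_univ_six, hκ0, hκ1]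
  ext i
  simp only [zero_smul, add_zero, zero_add, Pi.add_apply, Pi.smul_apply, smul_eq_mul, one_div,
    Matrix.cons_val_one, Matrix.cons_val_zero, Matrix.cons_val, Pi.sub_apply]
  field_simp
  ring

theorem eq_on_fibre_of_cderiv_Zbar_eq_zero (ha : a ≠ 0) (hc : c ≠ 0) (hf : Differentiable ℝ f)
    (hb : Bornology.IsBounded (Set.range f)) (h : ∀ j ≠ 0, ∀ q, cderiv (Zbar a b c j) f q = 0)
    {p q : E} (h0 : q 0 = p 0) (h1 : q 1 = p 1) : f q = f p := by
  have const_on_complexLine : ∀ j ≠ 0, ∀ p s t, f (complexLine a b c p j s t) = f p :=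
    fun j hj p => (eq_zero_and_const_of_cderiv_Zbar_eq ha hf hb fun _ _ => h j hj _).2
  obtain ⟨s, t, s', t', rfl⟩ := exists_eq_complexLine_complexLine ha b hc h0 h1
  rw [const_on_complexLine 2 (by decide), const_on_complexLine 1 (by decide)]

theorem eq_of_cderiv_Zbar_eq_zero (ha : a ≠ 0) (hc : c ≠ 0) (hf : Differentiable ℝ f)
    (hb : Bornology.IsBounded (Set.range f)) (h : ∀ j q, cderiv (Zbar a b c j) f q = 0) (p q : E) :
    f q = f p := by
  rw [← (eq_zero_and_const_of_cderiv_Zbar_eq ha hf hb (p := p) fun _ _ => h 0 _).2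
    (a * (q 0 - p 0)) (q 1 - p 1)]
  refine eq_on_fibre_of_cderiv_Zbar_eq_zero ha hc hf hb (fun j _ => h j) ?_ ?_
  · rw [complexLine_apply_zero ha, if_pos rfl]
    field_simp
    ring
  · rw [complexLine_apply_one ha, if_pos rfl, add_sub_cancel]

/-- The function `e^{-i r x}` on `G`, an eigenfunction of `Z̄₁` for the eigenvalue `r / 2`. -/
def wave (r : ℝ) (x : E) : ℂ := Complex.exp (-(r * x 1) * Complex.I)

theorem contDiff_wave (r : ℝ) : ContDiff ℝ ∞ (wave r) := by
  have coordinate : ContDiff ℝ ∞ fun x : E => (x 1 : ℂ) :=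
    Complex.ofRealCLM.contDiff.comp (contDiff_apply ℝ ℝ 1)
  exact ((contDiff_const.mul coordinate).neg.mul contDiff_const).cexp

theorem norm_wave (r : ℝ) (x : E) : ‖wave r x‖ = 1 := by
  rw [wave, ← Complex.ofReal_mul, ← Complex.ofReal_neg, Complex.norm_exp_ofReal_mul_I]

theorem wave_mul_wave_neg (r : ℝ) (x : E) : wave r x * wave (-r) x = 1 := by
  rw [wave, wave, ← Complex.exp_add, Complex.exp_eq_one_iff]
  exact ⟨0, by push_cast; ring⟩

theorem cderiv_wave (v : Fin 6 → ℂ) (r : ℝ) (x : E) :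
    cderiv v (wave r) x = -(v 1 * r * Complex.I) * wave r x := by
  have coordinate : HasFDerivAt (fun y : E => (y 1 : ℂ)) (Complex.ofRealCLM.comp
      (ContinuousLinearMap.proj 1 : E →L[ℝ] ℝ)) x :=
    (Complex.ofRealCLM.comp (ContinuousLinearMap.proj 1 : E →L[ℝ] ℝ)).hasFDerivAt
  have hderiv : HasFDerivAt (wave r) _ x :=
    ((coordinate.const_mul (r : ℂ)).fun_neg.mul_const Complex.I).cexp
  rw [cderiv, complexifyFunctional_apply, hderiv.fderiv, Fin.sum_univ_six]
  simp only [neg_mul, smul_neg, frameBasis_apply, frame, Matrix.cons_val_zero, neg_apply,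
    smul_apply, ContinuousLinearMap.comp_apply, ContinuousLinearMap.proj_apply, Matrix.cons_val_one,
    Complex.ofRealCLM_apply, Complex.ofReal_zero, smul_eq_mul, mul_zero, neg_zero,
    Complex.ofReal_one, mul_one, mul_neg, zero_add, Matrix.cons_val, add_zero, wave, neg_inj]
  ring

theorem cderiv_Zbar_wave (a b c r : ℝ) (x : E) (j : Fin 3) :
    cderiv (Zbar a b c j) (wave r) x = if j = 0 then r / 2 * wave r x else 0 := by
  rw [cderiv_wave, Zbar_eq]
  fin_cases j
  · simp only [one_div, mul_inv_rev, neg_mul, Fin.zero_eta, Matrix.cons_val', Matrix.cons_val_one,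
      Matrix.cons_val_zero, Matrix.cons_val_fin_one, ↓reduceIte]
    linear_combination -(r / 2 * wave r x) * Complex.I_mul_I
  · simp
  · simp

theorem eq_mul_wave_of_cderiv_Zbar (ha : a ≠ 0) (hc : c ≠ 0) (hf : Differentiable ℝ f)
    (hb : Bornology.IsBounded (Set.range f)) {r : ℝ}
    (h0 : ∀ q, cderiv (Zbar a b c 0) f q = r / 2 * f q)
    (h : ∀ j ≠ 0, ∀ q, cderiv (Zbar a b c j) f q = 0) (x : E) :
    f x = f 0 * wave r x := by
  have hwave : Differentiable ℝ (wave (-r)) := (contDiff_wave _).differentiable (by simp)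
  have hbounded : Bornology.IsBounded (Set.range (f * wave (-r))) := by
    obtain ⟨M, hM⟩ := hb.exists_norm_le
    refine isBounded_iff_forall_norm_le.mpr ⟨M, ?_⟩
    rintro - ⟨y, rfl⟩
    simpa [norm_wave] using hM _ ⟨y, rfl⟩
  have holomorphic : ∀ j q, cderiv (Zbar a b c j) (f * wave (-r)) q = 0 := by
    intro j q
    rw [cderiv_mul (hf q) (hwave q), cderiv_Zbar_wave]
    obtain rfl | hj := eq_or_ne j 0
    · rw [h0, if_pos rfl]
      push_cast
      ring
    · rw [h j hj, if_neg hj, mul_zero, mul_zero, add_zero]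
  have hconst := eq_of_cderiv_Zbar_eq_zero ha hc (hf.mul hwave) hbounded holomorphic 0 x
  have wave_zero : wave (-r) 0 = 1 := by simp [wave]
  rw [Pi.mul_apply, Pi.mul_apply, wave_zero, mul_one] at hconst
  rw [← hconst, mul_assoc, mul_comm (wave (-r) x), wave_mul_wave_neg, mul_one]

end CauchyRiemann

section Positivity

/-- The metric `g` at the point `x`, as a bilinear form. -/
def metricForm (a b c : ℝ) (x : E) : E →ₗ[ℝ] E →ₗ[ℝ] ℝ :=
  LinearMap.mk₂ ℝ (metric a b c x)
    (fun _ _ _ => by simp only [metric, omega, wedge₂, map_add]; ring)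
    (fun _ _ _ => by simp only [metric, omega, wedge₂, map_smul, smul_eq_mul]; ring)
    (fun _ _ _ => by simp only [metric, omega, wedge₂, map_add]; ring)
    (fun _ _ _ => by simp only [metric, omega, wedge₂, map_smul, smul_eq_mul]; ring)

theorem metricForm_apply (a b c : ℝ) (x v w : E) : metricForm a b c x v w = metric a b c x v w :=
  rfl

variable {a c : ℝ}

theorem linearIndependent_orthoFrame (ha : a ≠ 0) (b : ℝ) (hc : c ≠ 0) (x : E) :
    LinearIndependent ℝ (orthoFrame a b c x) := by
  refine LinearMap.linearIndependent_of_isOrthoᵢ (B := metricForm a b c x)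
    (LinearMap.isOrthoᵢ_def.mpr fun i j hij => ?_) fun i => ?_
  · rw [metricForm_apply, metric_orthoFrame ha hc, if_neg hij]
  · rw [metricForm_apply, metric_orthoFrame ha hc, if_pos rfl]
    exact one_ne_zero

/-- The `g`-orthonormal frame at the point `x`, as a basis. -/
def orthoBasis (ha : a ≠ 0) (b : ℝ) (hc : c ≠ 0) (x : E) : Module.Basis (Fin 6) ℝ E :=
  basisOfLinearIndependentOfCardEqFinrank (linearIndependent_orthoFrame ha b hc x) (by simp)

theorem coe_orthoBasis (ha : a ≠ 0) (b : ℝ) (hc : c ≠ 0) (x : E) :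
    ⇑(orthoBasis ha b hc x) = orthoFrame a b c x :=
  coe_basisOfLinearIndependentOfCardEqFinrank _ _

theorem volDensity_pos (ha : a ≠ 0) (b : ℝ) (hc : c ≠ 0) (x : E) : 0 < volDensity a b c x := by
  set M := LinearMap.toMatrix₂ (Pi.basisFun ℝ (Fin 6)) (Pi.basisFun ℝ (Fin 6)) (metricForm a b c x)
    with hM
  set U := (Pi.basisFun ℝ (Fin 6)).toMatrix (orthoBasis ha b hc x)
  have gram_orthoBasis : U.transpose * M * U = 1 := by
    rw [hM, LinearMap.toMatrix₂_mul_basis_toMatrix]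
    ext i j
    rw [LinearMap.toMatrix₂_apply, coe_orthoBasis, metricForm_apply, metric_orthoFrame ha hc,
      Matrix.one_apply]
  have det_eq : U.det * M.det * U.det = 1 := by
    simpa using congrArg Matrix.det gram_orthoBasis
  have det_pos : 0 < M.det := by
    by_contra! hneg
    nlinarith [sq_nonneg U.det]
  refine Real.sqrt_pos.mpr ?_
  convert det_pos using 2
  ext i j
  simp [hM, LinearMap.toMatrix₂_apply, metricForm_apply]

/-- The squared Hermitian norm of a complex-valued `k`-covector at the point `x`. -/
def hermNormSq (a b c : ℝ) (x : E) {k : ℕ} (α : E [⋀^Fin k]→L[ℝ] ℂ) : ℝ :=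
  1 / (k.factorial : ℝ) * ∑ I : Fin k → Fin 6, Complex.normSq (α (orthoFrame a b c x ∘ I))

variable {k : ℕ}

theorem hermProd_self (a b c : ℝ) (x : E) (α : E [⋀^Fin k]→L[ℝ] ℂ) :
    hermProd a b c x α α = hermNormSq a b c x α := by
  simp only [hermProd, hermNormSq, Complex.mul_conj]
  push_cast
  rfl

theorem hermNormSq_nonneg (a b c : ℝ) (x : E) (α : E [⋀^Fin k]→L[ℝ] ℂ) :
    0 ≤ hermNormSq a b c x α :=
  mul_nonneg (by positivity) (Finset.sum_nonneg fun _ _ => Complex.normSq_nonneg _)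

theorem eq_zero_of_hermNormSq_eq_zero (ha : a ≠ 0) {b : ℝ} (hc : c ≠ 0) {x : E}
    {α : E [⋀^Fin k]→L[ℝ] ℂ} (h : hermNormSq a b c x α = 0) : α = 0 := by
  have apply_orthoFrame : ∀ I : Fin k → Fin 6, α (orthoFrame a b c x ∘ I) = 0 := fun I => by
    have sum_eq_zero := (mul_eq_zero.mp h).resolve_left (by positivity)
    rw [Finset.sum_eq_zero_iff_of_nonneg fun _ _ => Complex.normSq_nonneg _] at sum_eq_zero
    exact Complex.normSq_eq_zero.mp (sum_eq_zero I (Finset.mem_univ I))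
  refine ContinuousAlternatingMap.toAlternatingMap_injective
    ((orthoBasis ha b hc x).ext_alternating fun I _ => ?_)
  rw [coe_orthoBasis]
  exact apply_orthoFrame I

theorem EvalCont.continuous_hermNormSq {α : Form k} (hα : EvalCont α) (a b c : ℝ) :
    Continuous fun x => hermNormSq a b c x (α x) :=
  continuous_const.mul (continuous_finsetSum _ fun I _ =>
    Complex.continuous_normSq.comp (hα _ fun i => continuous_orthoFrame a b c (I i)))

end Positivity

section FundamentalDomain

namespace LatticeData

variable (D : LatticeData)

/-- The linear map taking the half-open unit cube to the fundamental domain. -/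
def fundParam : E →L[ℝ] E :=
  LinearMap.toContinuousLinearMap
    { toFun := fun s => ![D.a₀ * s 0, s 1,
        D.P.val 0 0 * s 2 + D.P.val 0 1 * s 3, D.P.val 1 0 * s 2 + D.P.val 1 1 * s 3,
        D.P.val 0 0 * s 4 + D.P.val 0 1 * s 5, D.P.val 1 0 * s 4 + D.P.val 1 1 * s 5]
      map_add' := fun s r => by
        ext i
        fin_cases i <;> simp <;> ring
      map_smul' := fun r s => by
        ext i
        fin_cases i <;> simp <;> ring }

theorem fundParam_eq_iff (s g : E) : D.fundParam s = g ↔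
    g 0 = D.a₀ * s 0 ∧ g 1 = s 1 ∧ ![g 2, g 3] = D.P.val.mulVec ![s 2, s 3] ∧
      ![g 4, g 5] = D.P.val.mulVec ![s 4, s 5] := by
  rw [eq_comm]
  simp [funext_iff, Fin.forall_fin_succ, fundParam, and_assoc]

theorem fundDomain_eq_image :
    D.fundDomain = D.fundParam '' Set.univ.pi fun _ => Set.Ico (0 : ℝ) 1 := by
  ext g
  simp only [Set.mem_image, fundParam_eq_iff, Set.mem_univ_pi]
  rfl

theorem fundParam_surjective : Function.Surjective D.fundParam := by
  have mulVec_surjective (y₀ y₁ : ℝ) : ∃ s₀ s₁, ![y₀, y₁] = D.P.val.mulVec ![s₀, s₁] := by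
    have h := Matrix.mulVec_surjective_iff_isUnit.mpr D.P.isUnit ![y₀, y₁]
    obtain ⟨s, hs⟩ := h
    exact ⟨s 0, s 1, by rw [← hs]; congr 1; ext i; fin_cases i <;> rfl⟩
  intro g
  obtain ⟨s₂, s₃, hy⟩ := mulVec_surjective (g 2) (g 3)
  obtain ⟨s₄, s₅, hz⟩ := mulVec_surjective (g 4) (g 5)
  exact ⟨![g 0 / D.a₀, g 1, s₂, s₃, s₄, s₅],
    (D.fundParam_eq_iff _ g).mpr ⟨(mul_div_cancel₀ _ D.a₀_ne_zero).symm, rfl, hy, hz⟩⟩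

theorem interior_fundDomain_nonempty : (interior D.fundDomain).Nonempty := by
  rw [fundDomain_eq_image]
  refine Set.Nonempty.mono ((D.fundParam.isOpenMap D.fundParam_surjective).image_interior_subset _)
    (Set.Nonempty.image _ ?_)
  rw [interior_pi_set Set.finite_univ]
  simp [Set.univ_pi_nonempty_iff]

theorem convex_fundDomain : Convex ℝ D.fundDomain := by
  rw [fundDomain_eq_image]
  exact (convex_pi fun _ _ => convex_Ico 0 1).linear_image D.fundParam.toLinearMap

theorem fundDomain_subset_closure_interior : D.fundDomain ⊆ closure (interior D.fundDomain) := by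
  rw [D.convex_fundDomain.closure_interior_eq_closure_of_nonempty_interior
    D.interior_fundDomain_nonempty]
  exact subset_closure

end LatticeData

theorem eq_zero_of_l2Prod_self_eq_zero {D : LatticeData} {a b c : ℝ} (ha : a ≠ 0) (hc : c ≠ 0)
    {k : ℕ} {η : Form k} (hη : EvalCont η) (h : l2Prod D a b c η η = 0) {x : E}
    (hx : x ∈ D.fundDomain) : η x = 0 := by
  set F : E → ℝ := fun x => hermNormSq a b c x (η x) * volDensity a b c x
  have coe_F : ∀ x, hermProd a b c x (η x) (η x) * volDensity a b c x = (F x : ℂ) := fun x => by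
    rw [hermProd_self, ← Complex.ofReal_mul]
  have integrableOn_F : IntegrableOn F D.fundDomain := by
    have h := (integrable_hermProd D a b c hη hη).re
    simp only [coe_F, RCLike.re_to_complex, Complex.ofReal_re] at h
    exact h
  have integral_F : ∫ x in D.fundDomain, F x = 0 := by
    simp only [l2Prod, coe_F] at h
    rw [integral_complex_ofReal] at h
    exact_mod_cast h
  have ae_F : F =ᵐ[volume.restrict D.fundDomain] 0 :=
    (integral_eq_zero_iff_of_nonneg
      (fun x => mul_nonneg (hermNormSq_nonneg a b c x _) (volDensity_pos ha b hc x).le)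
      integrableOn_F).mp integral_F
  have continuous_F : Continuous F :=
    (hη.continuous_hermNormSq a b c).mul (continuous_volDensity a b c)
  have F_eq_zero : F x = 0 := Measure.eqOn_of_ae_eq ae_F continuous_F.continuousOn
    continuousOn_const D.fundDomain_subset_closure_interior hx
  exact eq_zero_of_hermNormSq_eq_zero ha hc
    ((mul_eq_zero.mp F_eq_zero).resolve_right (volDensity_pos ha b hc x).ne')

end FundamentalDomain

section Harmonic

theorem coframe_fderiv_leftTrans (γ : G) (x v : E) (i : Fin 6) :
    coframe (leftTrans γ x) i (fderiv ℝ (leftTrans γ) x v) = coframe x i v := by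
  conv_lhs => rw [← sum_coframe_smul_frame x v]
  simp only [map_sum, map_smul, fderiv_leftTrans_frame, coframe_frame, smul_eq_mul, mul_ite,
    mul_one, mul_zero, Finset.sum_ite_eq, Finset.mem_univ, if_true]

theorem J_fderiv_leftTrans (a b c : ℝ) (γ : G) (x v : E) :
    J a b c (leftTrans γ x) (fderiv ℝ (leftTrans γ) x v)
      = fderiv ℝ (leftTrans γ) x (J a b c x v) := by
  have on_frame : ∀ i, J a b c (leftTrans γ x) (fderiv ℝ (leftTrans γ) x (frame x i))
      = fderiv ℝ (leftTrans γ) x (J a b c x (frame x i)) := fun i => by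
    rw [fderiv_leftTrans_frame, J_frame, J_frame]
    fin_cases i <;> simp [fderiv_leftTrans_frame]
  rw [← sum_coframe_smul_frame x v]
  simp only [map_sum, map_smul, on_frame]

theorem typeProj_compContinuousLinearMap {J₁ J₂ L : E →L[ℝ] E} (h : ∀ v, J₂ (L v) = L (J₁ v))
    {k : ℕ} (p q : ℕ) (α : E [⋀^Fin k]→L[ℝ] ℂ) :
    typeProj J₁ p q (α.compContinuousLinearMap L)
      = (typeProj J₂ p q α).compContinuousLinearMap L := by
  ext v
  simp only [typeProj, ContinuousAlternatingMap.smul_apply, ContinuousAlternatingMap.sum_apply,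
    ContinuousAlternatingMap.compContinuousLinearMap_apply]
  refine congrArg _ (Finset.sum_congr rfl fun j _ => congrArg _ (congrArg α (funext fun m => ?_)))
  simp [h]

variable {D : LatticeData} {a b c : ℝ} {p q : ℕ}

theorem dbar_leftTrans {ψ : Form (p + q)} (hψ : ψ ∈ forms D a b c p q) {γ : G}
    (hγ : γ ∈ D.lattice) (x : E) :
    (dbar a b c p q ψ (leftTrans γ x)).compContinuousLinearMap (fderiv ℝ (leftTrans γ) x)
      = dbar a b c p q ψ x := by
  have extDeriv_invariant : extDeriv ψ x =
      (extDeriv ψ (leftTrans γ x)).compContinuousLinearMap (fderiv ℝ (leftTrans γ) x) := by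
    rw [← extDeriv_pullback (r := ∞) (hψ.1.differentiable (by simp) (leftTrans γ x))
      (contDiff_leftTrans γ).contDiffAt
      (by rw [minSmoothness_of_isRCLikeNormedField]; exact WithTop.coe_le_coe.mpr le_top)]
    congr 1
    exact funext fun y => (hψ.2.1 γ hγ y).symm
  rw [dbar, dbar, extDeriv_invariant]
  exact (typeProj_compContinuousLinearMap (J_fderiv_leftTrans a b c γ x) p (q + 1) _).symm

theorem dbar_eq_zero_of_l2Prod_self_eq_zero (ha : a ≠ 0) (hc : c ≠ 0) {ψ : Form (p + q)}
    (hψ : ψ ∈ forms D a b c p q)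
    (h : l2Prod D a b c (dbar a b c p q ψ) (dbar a b c p q ψ) = 0) : dbar a b c p q ψ = 0 := by
  funext x
  obtain ⟨γ, ⟨hγ, hx⟩, -⟩ := D.existsUnique_mem_fundDomain x
  have on_fundDomain : dbar a b c p q ψ (leftTrans γ x) = 0 :=
    eq_zero_of_l2Prod_self_eq_zero ha hc (.dbar hψ) h hx
  rw [← dbar_leftTrans hψ hγ x, on_fundDomain]
  rfl

theorem mem_harmonic_iff (ha : a ≠ 0) (hc : c ≠ 0) {ψ : Form (p + 0)} :
    ψ ∈ harmonic D a b c p 0 ↔ ψ ∈ forms D a b c p 0 ∧ ∀ x, dbar a b c p 0 ψ x = 0 := by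
  have l2Prod_zero_right : ∀ {k : ℕ} (α : Form k), l2Prod D a b c α 0 = 0 := fun α => by
    simp [l2Prod, hermProd]
  constructor
  · rintro ⟨hψ, -, h⟩
    exact ⟨hψ, congrFun (dbar_eq_zero_of_l2Prod_self_eq_zero ha hc hψ
      ((h ψ hψ).trans (l2Prod_zero_right ψ)))⟩
  · rintro ⟨hψ, h⟩
    refine ⟨hψ, Submodule.zero_mem _, fun β _ => ?_⟩
    rw [show dbar a b c p 0 ψ = 0 from funext h, l2Prod_zero_right, l2Prod_zero_right]

end Harmonic

section HolomorphicForms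

theorem contDiff_of_contDiff_apply {U V : Type*} [NormedAddCommGroup U] [NormedSpace ℝ U]
    [NormedAddCommGroup V] [NormedSpace ℝ V] [FiniteDimensional ℝ V] {ι : Type*} [Fintype ι]
    {r : WithTop ℕ∞} {ψ : U → V [⋀^ι]→L[ℝ] ℂ} (h : ∀ v, ContDiff ℝ r fun x => ψ x v) :
    ContDiff ℝ r ψ := by
  classical
  let e := Module.finBasis ℝ V
  let ev : (V [⋀^ι]→L[ℝ] ℂ) →ₗ[ℝ] ((ι → Fin (Module.finrank ℝ V)) → ℂ) :=
    { toFun := fun α I => α (e ∘ I)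
      map_add' := fun _ _ => rfl
      map_smul' := fun _ _ => rfl }
  have ker_ev : LinearMap.ker ev = ⊥ := LinearMap.ker_eq_bot.mpr fun α β hαβ =>
    ContinuousAlternatingMap.toAlternatingMap_injective
      (e.ext_alternating fun I _ => congrFun hαβ I)
  obtain ⟨inv, hinv⟩ := ev.exists_leftInverse_of_injective ker_ev
  have ψ_eq : ψ = fun x => LinearMap.toContinuousLinearMap inv (ev (ψ x)) :=
    funext fun x => (LinearMap.congr_fun hinv (ψ x)).symm
  rw [ψ_eq]
  exact (LinearMap.toContinuousLinearMap inv).contDiff.comp (contDiff_pi.mpr fun I => h _)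

/-- The wedge product of complex-valued `1`-covectors. -/
def wedge {V : Type*} [AddCommGroup V] [Module ℝ V] [TopologicalSpace V] {k : ℕ}
    (φ : Fin k → (V →L[ℝ] ℂ)) : V [⋀^Fin k]→L[ℝ] ℂ :=
  ContinuousMultilinearMap.alternatization
    ((ContinuousMultilinearMap.mkPiAlgebra ℝ (Fin k) ℂ).compContinuousLinearMap φ)

theorem wedge_apply {V : Type*} [AddCommGroup V] [Module ℝ V] [TopologicalSpace V] {k : ℕ}
    (φ : Fin k → (V →L[ℝ] ℂ)) (v : Fin k → V) :
    wedge φ v = Matrix.det (Matrix.of fun i j => φ i (v j)) := by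
  rw [wedge, ContinuousMultilinearMap.alternatization_apply_apply, ← Matrix.det_transpose,
    Matrix.det_apply]
  simp [Function.comp_def]

theorem contDiff_wedge {U V : Type*} [NormedAddCommGroup U] [NormedSpace ℝ U]
    [NormedAddCommGroup V] [NormedSpace ℝ V] [FiniteDimensional ℝ V] {k : ℕ} {r : WithTop ℕ∞}
    {φ : U → Fin k → (V →L[ℝ] ℂ)} (hφ : ∀ m v, ContDiff ℝ r fun x => φ x m v) :
    ContDiff ℝ r fun x => wedge (φ x) := by
  refine contDiff_of_contDiff_apply fun v => ?_
  simp only [wedge_apply, Matrix.det_apply', Matrix.of_apply]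
  exact ContDiff.sum fun σ _ => contDiff_const.mul (contDiff_prod fun i _ => hφ _ _)

/-- The coefficients in the left-invariant coframe of the `1`-forms `θ`. -/
def thetaCoeff (a b c : ℝ) : Fin 3 → Fin 6 → ℂ :=
  ![![a, Complex.I, 0, 0, 0, 0], ![0, 0, 1, 0, b / c, Complex.I / c],
    ![0, 0, 0, 1, Complex.I / c, 0]]

/-- The left-invariant coframe of type `(1,0)` dual to `Z₁, Z₂, Z₃`. -/
def theta (a b c : ℝ) (x : E) (j : Fin 3) : E →L[ℝ] ℂ :=
  ∑ i, thetaCoeff a b c j i • Complex.ofRealCLM.comp (coframe x i)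

theorem theta_apply (a b c : ℝ) (x : E) (j : Fin 3) (v : E) :
    theta a b c x j v = ∑ i, thetaCoeff a b c j i * (coframe x i v : ℂ) := by
  simp [theta]

theorem theta_frame (a b c : ℝ) (x : E) (j : Fin 3) (i : Fin 6) :
    theta a b c x j (frame x i) = thetaCoeff a b c j i := by
  simp [theta_apply, coframe_frame, apply_ite (fun r : ℝ => (r : ℂ))]

theorem theta_fderiv_leftTrans (a b c : ℝ) (γ : G) (x : E) (j : Fin 3) (v : E) :
    theta a b c (leftTrans γ x) j (fderiv ℝ (leftTrans γ) x v) = theta a b c x j v := by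
  simp only [theta_apply, coframe_fderiv_leftTrans]

theorem contDiff_theta (a b c : ℝ) (j : Fin 3) (v : E) :
    ContDiff ℝ ∞ fun x => theta a b c x j v := by
  have contDiff_coord : ∀ i : Fin 6, ContDiff ℝ ∞ fun x : E => x i := contDiff_apply ℝ ℝ
  have contDiff_coframe : ∀ i, ContDiff ℝ ∞ fun x => coframe x i v := fun i => by
    have h₀ := contDiff_coord 0
    have h₁ := contDiff_coord 1
    fin_cases i <;> simp [coframe] <;> fun_prop
  simp only [theta_apply]
  exact ContDiff.sum fun i _ =>
    contDiff_const.mul (Complex.ofRealCLM.contDiff.comp (contDiff_coframe i))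

variable {a c : ℝ}

theorem theta_J (ha : a ≠ 0) (b : ℝ) (hc : c ≠ 0) (x : E) (j : Fin 3) (v : E) :
    theta a b c x j (J a b c x v) = Complex.I * theta a b c x j v := by
  have ha' : (a : ℂ) ≠ 0 := by exact_mod_cast ha
  have hc' : (c : ℂ) ≠ 0 := by exact_mod_cast hc
  have on_frame : ∀ i, theta a b c x j (J a b c x (frame x i))
      = Complex.I * theta a b c x j (frame x i) := fun i => by
    rw [J_frame]
    fin_cases j <;> fin_cases i <;> simp [theta_frame, thetaCoeff] <;> field_simp <;> simp
  rw [← sum_coframe_smul_frame x v]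
  simp only [map_sum, map_smul, on_frame, Finset.mul_sum, mul_smul_comm]

theorem complexifyFunctional_theta_Z (ha : a ≠ 0) (b : ℝ) (hc : c ≠ 0) (x : E) (j l : Fin 3) :
    complexifyFunctional (frameBasis x) (theta a b c x j) (Z a b c l) = if j = l then 1 else 0 := by
  have ha' : (a : ℂ) ≠ 0 := by exact_mod_cast ha
  have hc' : (c : ℂ) ≠ 0 := by exact_mod_cast hc
  have hI : Complex.I ^ 2 = -1 := Complex.I_sq
  simp only [complexifyFunctional_apply, frameBasis_apply, theta_frame, Fin.sum_univ_six]
  fin_cases j <;> fin_cases l <;>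
    simp [Z, thetaCoeff] <;> field_simp <;> ring_nf <;> simp only [hI] <;> ring

/-- The form `f θ_{I₁} ∧ ⋯ ∧ θ_{I_p}` of type `(p,0)`. -/
def monomialForm (a b c : ℝ) {p : ℕ} (f : E → ℂ) (I : Fin p → Fin 3) : Form p :=
  fun x => f x • wedge (theta a b c x ∘ I)

variable {b : ℝ} {p : ℕ} {f : E → ℂ}

theorem monomialForm_mem_forms {D : LatticeData} (ha : a ≠ 0) (hc : c ≠ 0) (hf : ContDiff ℝ ∞ f)
    (hD : IsLatticeInvariant D f) (I : Fin p → Fin 3) :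
    monomialForm a b c f I ∈ forms D a b c p 0 := by
  refine ⟨hf.smul (contDiff_wedge fun m => contDiff_theta a b c (I m)), fun γ hγ x => ?_,
    fun x => ?_⟩
  · ext v
    change f (leftTrans γ x) • wedge (theta a b c (leftTrans γ x) ∘ I)
      (fun j => fderiv ℝ (leftTrans γ) x (v j)) = f x • wedge (theta a b c x ∘ I) v
    simp only [hD γ hγ, wedge_apply, Function.comp_apply, theta_fderiv_leftTrans]
  · exact Submodule.smul_mem _ _ (Submodule.subset_span ⟨rfl, theta a b c x ∘ I,
      fun i _ => theta_J ha b hc x (I i), fun i hi => absurd i.2 hi.not_gt, wedge_apply _⟩)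

theorem coef_monomialForm (ha : a ≠ 0) (hc : c ≠ 0) (f : E → ℂ) (I K : Fin p → Fin 3) (x : E) :
    coef a b c (monomialForm a b c f I) K x
      = f x * Matrix.det (Matrix.of fun i j => if I i = K j then (1 : ℂ) else 0) := by
  rw [coef, monomialForm, map_smul, AlternatingMap.smul_apply,
    complexify_of_eq_det _ (wedge_apply _), smul_eq_mul]
  simp only [Function.comp_apply, complexifyFunctional_theta_Z ha b hc]

end HolomorphicForms

section DbarSystems

theorem sum_removeNth_two (S : Fin 3 → Fin 3 → ℂ) (g : (Fin 2 → Fin 3) → ℂ) (u v : Fin 3) :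
    ∑ m : Fin 2, (-1) ^ (m : ℕ) * ∑ l, S (![u, v] m) l * g (Matrix.vecCons l (m.removeNth ![u, v]))
      = ∑ l, S u l * g ![l, v] - ∑ l, S v l * g ![l, u] := by
  have remove_zero : Fin.removeNth 0 ![u, v] = ![v] := by ext m; fin_cases m; rfl
  have remove_one : Fin.removeNth 1 ![u, v] = ![u] := by ext m; fin_cases m; rfl
  rw [Fin.sum_univ_two, remove_zero, remove_one]
  simp [sub_eq_add_neg]

theorem sum_removeNth_three (S : Fin 3 → Fin 3 → ℂ) (g : (Fin 3 → Fin 3) → ℂ) (u v w : Fin 3) :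
    ∑ m : Fin 3, (-1) ^ (m : ℕ) *
        ∑ l, S (![u, v, w] m) l * g (Matrix.vecCons l (m.removeNth ![u, v, w]))
      = ∑ l, S u l * g ![l, v, w] - ∑ l, S v l * g ![l, u, w] + ∑ l, S w l * g ![l, u, v] := by
  have remove_zero : Fin.removeNth 0 ![u, v, w] = ![v, w] := by ext m; fin_cases m <;> rfl
  have remove_one : Fin.removeNth 1 ![u, v, w] = ![u, w] := by ext m; fin_cases m <;> rfl
  have remove_two : Fin.removeNth 2 ![u, v, w] = ![u, v] := by ext m; fin_cases m <;> rfl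
  rw [Fin.sum_univ_three, remove_zero, remove_one, remove_two]
  simp [sub_eq_add_neg]

theorem forall_strictMono_one {P : (Fin 1 → Fin 3) → Prop} :
    (∀ I, StrictMono I → P I) ↔ ∀ i, P ![i] := by
  refine ⟨fun h i => h _ (Subsingleton.strictMono _), fun h I _ => ?_⟩
  rw [← show ![I 0] = I from funext fun m => by rw [Subsingleton.elim m 0]; rfl]
  exact h (I 0)

theorem forall_strictMono_two {P : (Fin 2 → Fin 3) → Prop} :
    (∀ I, StrictMono I → P I) ↔ P ![0, 1] ∧ P ![0, 2] ∧ P ![1, 2] := by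
  have strictMono_iff : ∀ I : Fin 2 → Fin 3,
      StrictMono I ↔ I = ![0, 1] ∨ I = ![0, 2] ∨ I = ![1, 2] := by
    simp only [Fin.strictMono_iff_lt_succ]
    decide
  simp [strictMono_iff, or_imp, forall_and]

theorem forall_strictMono_three {P : (Fin 3 → Fin 3) → Prop} :
    (∀ I, StrictMono I → P I) ↔ P ![0, 1, 2] := by
  have strictMono_iff : ∀ I : Fin 3 → Fin 3, StrictMono I ↔ I = ![0, 1, 2] := by
    simp only [Fin.strictMono_iff_lt_succ]
    decide
  simp [strictMono_iff]

variable {D : LatticeData} {a b c : ℝ}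

theorem coef_eq_zero_of_eq {k : ℕ} (ψ : Form k) {I : Fin k → Fin 3} {i j : Fin k}
    (h : I i = I j) (hij : i ≠ j) (x : E) : coef a b c ψ I x = 0 :=
  (complexify (frameBasis x) (ψ x)).map_eq_zero_of_eq _ (congrArg (Z a b c) h) hij

theorem coef_swap (ψ : Form 2) (u v : Fin 3) (x : E) :
    coef a b c ψ ![v, u] x = -coef a b c ψ ![u, v] x := by
  have swap_eq : Z a b c ∘ ![v, u] = (Z a b c ∘ ![u, v]) ∘ Equiv.swap 0 1 := by
    ext m
    fin_cases m <;> rfl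
  rw [coef, swap_eq, AlternatingMap.map_swap _ _ zero_ne_one]
  rfl

theorem mem_harmonic_one_iff (ha : a ≠ 0) (hc : c ≠ 0) {ψ : Form 1} :
    ψ ∈ harmonic D a b c 1 0 ↔ ψ ∈ forms D a b c 1 0 ∧
      ∀ x (j i : Fin 3), cderiv (Zbar a b c j) (coef a b c ψ ![i]) x
        = ∑ l, structZ a c j i l * coef a b c ψ ![l] x := by
  refine (mem_harmonic_iff ha hc).trans (and_congr_right fun hψ => forall_congr' fun x => ?_)
  refine (dbar_eq_zero_iff (k := 0) ha hc (hψ.1.differentiable (by simp) x) hψ.2.2).trans ?_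
  refine forall_congr' fun j => forall_strictMono_one.trans (forall_congr' fun i => ?_)
  simp

theorem mem_harmonic_two_iff (ha : a ≠ 0) (hc : c ≠ 0) {ψ : Form 2} :
    ψ ∈ harmonic D a b c 2 0 ↔ ψ ∈ forms D a b c 2 0 ∧ ∀ x,
      (∀ j, cderiv (Zbar a b c j) (coef a b c ψ ![0, 1]) x = (![c / 4 * coef a b c ψ ![0, 2] x,
        c / 4 * coef a b c ψ ![1, 2] x, -1 / (2 * a) * coef a b c ψ ![1, 2] x] : Fin 3 → ℂ) j) ∧
      (∀ j, cderiv (Zbar a b c j) (coef a b c ψ ![0, 2]) x = (![c / 4 * coef a b c ψ ![0, 1] x,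
        -1 / (2 * a) * coef a b c ψ ![1, 2] x, -c / 4 * coef a b c ψ ![1, 2] x] : Fin 3 → ℂ) j) ∧
      ∀ j, cderiv (Zbar a b c j) (coef a b c ψ ![1, 2]) x = 0 := by
  have repeated : ∀ u x, coef a b c ψ ![u, u] x = 0 := fun u =>
    coef_eq_zero_of_eq ψ (i := 0) (j := 1) rfl zero_ne_one
  refine (mem_harmonic_iff ha hc).trans (and_congr_right fun hψ => forall_congr' fun x => ?_)
  refine (dbar_eq_zero_iff (k := 1) ha hc (hψ.1.differentiable (by simp) x) hψ.2.2).trans ?_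
  refine (forall_congr' fun j => forall_strictMono_two).trans ?_
  rw [forall_and, forall_and]
  refine and_congr ?_ (and_congr ?_ ?_) <;>
    refine forall_congr' fun j => Eq.congr_right
      ((sum_removeNth_two (structZ a c j) (coef a b c ψ · x) _ _).trans ?_) <;>
    simp only [Fin.sum_univ_three, repeated, coef_swap ψ 0 1, coef_swap ψ 0 2, coef_swap ψ 1 2] <;>
    fin_cases j <;> simp [structZ, neg_div]

theorem mem_harmonic_three_iff (ha : a ≠ 0) (hc : c ≠ 0) {ψ : Form 3} :
    ψ ∈ harmonic D a b c 3 0 ↔ ψ ∈ forms D a b c 3 0 ∧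
      ∀ x j, cderiv (Zbar a b c j) (coef a b c ψ ![0, 1, 2]) x = 0 := by
  have repeated_first : ∀ u w x, coef a b c ψ ![u, u, w] x = 0 := fun u w =>
    coef_eq_zero_of_eq ψ (i := 0) (j := 1) rfl (by decide)
  have repeated_last : ∀ u v x, coef a b c ψ ![u, v, u] x = 0 := fun u v =>
    coef_eq_zero_of_eq ψ (i := 0) (j := 2) rfl (by decide)
  refine (mem_harmonic_iff ha hc).trans (and_congr_right fun hψ => forall_congr' fun x => ?_)
  refine (dbar_eq_zero_iff (k := 2) ha hc (hψ.1.differentiable (by simp) x) hψ.2.2).trans ?_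
  refine forall_congr' fun j => forall_strictMono_three.trans (Eq.congr_right ?_)
  refine (sum_removeNth_three (structZ a c j) (coef a b c ψ · x) 0 1 2).trans ?_
  simp only [Fin.sum_univ_three, repeated_first, repeated_last]
  fin_cases j <;> simp [structZ]

end DbarSystems

section HodgeNumbers

variable {D : LatticeData} {a b c : ℝ}

/-- The values at the origin of a family of coefficients of a harmonic form. -/
def coefAtZero (D : LatticeData) (a b c : ℝ) (p : ℕ) {n : ℕ} (K : Fin n → Fin p → Fin 3) :
    harmonic D a b c p 0 →ₗ[ℂ] (Fin n → ℂ) where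
  toFun ψ i := coef a b c (k := p) ψ.1 (K i) 0
  map_add' ψ χ := funext fun i => by
    change complexify _ (ψ.1 0 + χ.1 0) _ = _
    rw [map_add]
    rfl
  map_smul' r ψ := funext fun i => by
    change complexify _ (r • ψ.1 0) _ = _
    rw [map_smul]
    rfl

theorem hodgeNumber_eq {p n : ℕ} {K : Fin n → Fin p → Fin 3}
    (hinj : ∀ ψ : Form p, ψ ∈ harmonic D a b c p 0 → (∀ i, coef a b c ψ (K i) 0 = 0) → ψ = 0)
    (hsurj : ∀ r : Fin n → ℂ, ∃ ψ : Form p,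
      ψ ∈ harmonic D a b c p 0 ∧ ∀ i, coef a b c ψ (K i) 0 = r i) :
    hodgeNumber D a b c p 0 = n := by
  have bijective : Function.Bijective (coefAtZero D a b c p K) := by
    refine ⟨(injective_iff_map_eq_zero _).mpr fun ψ hψ => ?_, fun r => ?_⟩
    · exact Subtype.ext (hinj ψ.1 ψ.2 fun i => congrFun hψ i)
    · obtain ⟨ψ, hψ, hr⟩ := hsurj r
      exact ⟨⟨ψ, hψ⟩, funext hr⟩
  rw [hodgeNumber, (LinearEquiv.ofBijective _ bijective).rank_eq, rank_fin_fun]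

theorem differentiable_of_mem_harmonic {p q : ℕ} {ψ : Form (p + q)}
    (hψ : ψ ∈ harmonic D a b c p q) : Differentiable ℝ ψ :=
  hψ.1.1.differentiable (by simp)

theorem eq_zero_of_mem_harmonic {p : ℕ} (ha : a ≠ 0) (hc : c ≠ 0) {ψ : Form p}
    (hψ : ψ ∈ harmonic D a b c p 0)
    (h : ∀ I : Fin p → Fin 3, StrictMono I → ∀ x, coef a b c ψ I x = 0) : ψ = 0 :=
  funext fun x => eq_zero_of_coef_eq_zero ha hc (hψ.1.2.2 x) fun I hI => h I hI x

theorem isLatticeInvariant_const (D : LatticeData) (r : ℂ) : IsLatticeInvariant D fun _ => r :=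
  fun _ _ _ => rfl

/-- The translation of the `x`-coordinate by one period. -/
def unitShift : G := (![0, 1, 0, 0, 0, 0] : E)

theorem unitShift_mem (D : LatticeData) : unitShift ∈ D.lattice := by
  have vec_zero : ![0, 0] = D.vec 0 := by
    ext i
    fin_cases i <;> simp [LatticeData.vec]
  exact ⟨0, 1, 0, 0, by simp [unitShift], by simp [unitShift], vec_zero, vec_zero⟩

theorem isLatticeInvariant_wave_iff (D : LatticeData) (r : ℝ) :
    IsLatticeInvariant D (wave r) ↔ ∃ n : ℤ, r = 2 * Real.pi * n := by
  constructor
  · intro h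
    have period : Complex.exp (-(r : ℂ) * Complex.I) = 1 := by
      simpa [wave, leftTrans, gmul, unitShift, G.coords] using h _ (unitShift_mem D) 0
    obtain ⟨n, hn⟩ := Complex.exp_eq_one_iff.mp period
    refine ⟨-n, ?_⟩
    have : (r : ℂ) = 2 * Real.pi * -n := by
      apply mul_right_cancel₀ Complex.I_ne_zero
      linear_combination -hn
    exact_mod_cast this
  · rintro ⟨n, rfl⟩ γ ⟨_, u, _, _, _, hu, _, _⟩ x
    have coordinate : leftTrans γ x 1 = u + x 1 := congrArg (· + x 1) hu
    rw [wave, wave, coordinate, Complex.exp_eq_exp_iff_exists_int]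
    refine ⟨-(n * u), ?_⟩
    push_cast
    ring

section OneForms

variable {ψ : Form 1}

theorem structZ_eq_zero (a c : ℝ) {j i : Fin 3} (hj : j ≠ 0) (hi : i ≠ 0) (l : Fin 3) :
    structZ a c j i l = 0 := by
  fin_cases j <;> fin_cases i <;> fin_cases l <;> simp_all [structZ]

theorem coef_eq_zero_of_mem_harmonic_one (ha : a ≠ 0) (hc : c ≠ 0)
    (hψ : ψ ∈ harmonic D a b c 1 0) (x : E) :
    coef a b c ψ ![1] x = 0 ∧ coef a b c ψ ![2] x = 0 := by
  obtain ⟨hforms, system⟩ := (mem_harmonic_one_iff ha hc).mp hψ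
  have hdiff := fun i => differentiable_coef (a := a) (b := b) (c := c)
    (differentiable_of_mem_harmonic hψ) ![i]
  have hbounded := fun i => isBounded_range_coef (p := 1) hforms ![i]
  have const_on_fibre : ∀ i ≠ 0, ∀ q : E, q 0 = x 0 → q 1 = x 1 →
      coef a b c ψ ![i] q = coef a b c ψ ![i] x := fun i hi q h0 h1 =>
    eq_on_fibre_of_cderiv_Zbar_eq_zero (b := b) ha hc (hdiff i) (hbounded i) (fun j hj q => by
      simp [system q j i, structZ_eq_zero a c hj hi]) h0 h1
  have combination_eq_zero : ∀ j ≠ 0,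
      structZ a c j 0 1 * coef a b c ψ ![1] x + structZ a c j 0 2 * coef a b c ψ ![2] x = 0 :=
    fun j hj => eq_zero_of_cderiv_Zbar_eq_on_fibre ha (hdiff 0) (hbounded 0) hj fun q h0 h1 => by
      rw [system q j 0, Fin.sum_univ_three, const_on_fibre 1 (by decide) q h0 h1,
        const_on_fibre 2 (by decide) q h0 h1]
      fin_cases j <;> simp [structZ]
  have first := combination_eq_zero 1 (by decide)
  have second := combination_eq_zero 2 (by decide)
  simp only [structZ, one_div, mul_inv_rev, Matrix.cons_val', Matrix.cons_val_zero,
    Matrix.cons_val_fin_one, Matrix.cons_val_one, Matrix.cons_val] at first second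
  have determinant : (1 / (4 * a ^ 2) + c ^ 2 / 16 : ℂ) ≠ 0 := by
    have : (1 / (4 * a ^ 2) + c ^ 2 / 16 : ℝ) ≠ 0 := by positivity
    exact_mod_cast this
  constructor <;> refine (mul_eq_zero.mp ?_).resolve_left determinant
  · linear_combination -1 / (2 * a) * first - c / 4 * second
  · linear_combination -c / 4 * first + 1 / (2 * a) * second

theorem coef_eq_of_mem_harmonic_one (ha : a ≠ 0) (hc : c ≠ 0)
    (hψ : ψ ∈ harmonic D a b c 1 0) (x : E) : coef a b c ψ ![0] x = coef a b c ψ ![0] 0 := by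
  obtain ⟨hforms, system⟩ := (mem_harmonic_one_iff ha hc).mp hψ
  refine eq_of_cderiv_Zbar_eq_zero (b := b) ha hc
    (differentiable_coef (differentiable_of_mem_harmonic hψ) _)
    (isBounded_range_coef (p := 1) hforms _) (fun j q => ?_) 0 x
  obtain ⟨h1, h2⟩ := coef_eq_zero_of_mem_harmonic_one ha hc hψ q
  rw [system q j 0, Fin.sum_univ_three, h1, h2]
  fin_cases j <;> simp [structZ]

theorem monomialForm_mem_harmonic_one (D : LatticeData) (ha : a ≠ 0) (b : ℝ) (hc : c ≠ 0) (r : ℂ) :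
    monomialForm a b c (fun _ => r) ![0] ∈ harmonic D a b c 1 0 := by
  refine (mem_harmonic_one_iff ha hc).mpr ⟨monomialForm_mem_forms (p := 1) ha hc contDiff_const
    (isLatticeInvariant_const D r) _, fun x j i => ?_⟩
  have coef_eq : ∀ i, coef a b c (monomialForm a b c (fun _ => r) ![0]) ![i]
      = fun _ => if 0 = i then r else 0 := fun i => by
    funext x
    simp [coef_monomialForm ha hc]
  simp only [coef_eq, cderiv_const, Fin.sum_univ_three]
  fin_cases j <;> fin_cases i <;> simp [structZ]

theorem hodgeNumber_one (D : LatticeData) (ha : a ≠ 0) (b : ℝ) (hc : c ≠ 0) :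
    hodgeNumber D a b c 1 0 = 1 := by
  rw [← Nat.cast_one]
  refine hodgeNumber_eq (K := ![![0]]) (fun ψ hψ hzero => ?_) fun r => ?_
  · refine eq_zero_of_mem_harmonic ha hc hψ (forall_strictMono_one.mpr fun i x => ?_)
    obtain ⟨h1, h2⟩ := coef_eq_zero_of_mem_harmonic_one ha hc hψ x
    have h0 := (coef_eq_of_mem_harmonic_one ha hc hψ x).trans (hzero 0)
    fin_cases i <;> assumption
  · refine ⟨_, monomialForm_mem_harmonic_one D ha b hc (r 0), fun i => ?_⟩
    rw [Subsingleton.elim i 0, coef_monomialForm ha hc]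
    simp

end OneForms

section ThreeForms

theorem hodgeNumber_three (D : LatticeData) (ha : a ≠ 0) (b : ℝ) (hc : c ≠ 0) :
    hodgeNumber D a b c 3 0 = 1 := by
  rw [← Nat.cast_one]
  refine hodgeNumber_eq (K := ![![0, 1, 2]]) (fun ψ hψ hzero => ?_) fun r => ?_
  · obtain ⟨hforms, holomorphic⟩ := (mem_harmonic_three_iff ha hc).mp hψ
    refine eq_zero_of_mem_harmonic ha hc hψ (forall_strictMono_three.mpr fun x => ?_)
    exact (eq_of_cderiv_Zbar_eq_zero ha hc (differentiable_coef (differentiable_of_mem_harmonic hψ)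
      _) (isBounded_range_coef (p := 3) hforms _) (fun j q => holomorphic q j) 0 x).trans (hzero 0)
  · have coef_eq : coef a b c (monomialForm a b c (fun _ => r 0) ![0, 1, 2]) ![0, 1, 2]
        = fun _ => r 0 := by
      funext x
      simp [coef_monomialForm ha hc, Matrix.det_fin_three]
    refine ⟨monomialForm a b c (fun _ => r 0) ![0, 1, 2], (mem_harmonic_three_iff ha hc).mpr
      ⟨monomialForm_mem_forms (p := 3) ha hc contDiff_const (isLatticeInvariant_const D _) _,
        fun x j => by rw [coef_eq, cderiv_const]⟩, fun i => ?_⟩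
    rw [Subsingleton.elim i 0]
    exact congrFun coef_eq 0

end ThreeForms

section TwoForms

variable {ψ : Form 2}

theorem coef_one_two_eq_zero_of_mem_harmonic_two (ha : a ≠ 0) (hc : c ≠ 0)
    (hψ : ψ ∈ harmonic D a b c 2 0) (x : E) : coef a b c ψ ![1, 2] x = 0 := by
  obtain ⟨hforms, system⟩ := (mem_harmonic_two_iff ha hc).mp hψ
  have hdiff := differentiable_coef (a := a) (b := b) (c := c) (differentiable_of_mem_harmonic hψ)
  have hbounded := isBounded_range_coef (p := 2) hforms
  have hconst := eq_of_cderiv_Zbar_eq_zero (b := b) ha hc (hdiff ![1, 2]) (hbounded _)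
    fun j q => (system q).2.2 j
  have multiple_eq_zero : c / 4 * coef a b c ψ ![1, 2] x = 0 :=
    eq_zero_of_cderiv_Zbar_eq_on_fibre (p := x) (j := 1) ha (hdiff ![0, 1]) (hbounded _) (by decide)
      fun q _ _ => by rw [(system q).1, ← hconst x q]; rfl
  exact (mul_eq_zero.mp multiple_eq_zero).resolve_left (by simpa using hc)

theorem coef_add_smul_coef_eq_mul_wave (ha : a ≠ 0) (hc : c ≠ 0)
    (hψ : ψ ∈ harmonic D a b c 2 0) {ε : ℝ} (hε : ε ^ 2 = 1) (x : E) :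
    coef a b c ψ ![0, 1] x + ε * coef a b c ψ ![0, 2] x
      = (coef a b c ψ ![0, 1] 0 + ε * coef a b c ψ ![0, 2] 0) * wave (ε * (c / 2)) x := by
  obtain ⟨hforms, system⟩ := (mem_harmonic_two_iff ha hc).mp hψ
  have hdiff := differentiable_coef (a := a) (b := b) (c := c) (differentiable_of_mem_harmonic hψ)
  have hbounded := isBounded_range_coef (p := 2) hforms
  have hzero := coef_one_two_eq_zero_of_mem_harmonic_two ha hc hψ
  have hε' : (ε : ℂ) ^ 2 = 1 := by exact_mod_cast hε
  have bounded : Bornology.IsBounded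
      (Set.range (coef a b c ψ ![0, 1] + (ε : ℂ) • coef a b c ψ ![0, 2])) := by
    refine ((hbounded ![0, 1]).add ((hbounded ![0, 2]).smul₀ (ε : ℂ))).subset ?_
    rintro - ⟨y, rfl⟩
    exact Set.add_mem_add ⟨y, rfl⟩ (Set.smul_mem_smul_set ⟨y, rfl⟩)
  have cderiv_eq : ∀ j q, cderiv (Zbar a b c j) (coef a b c ψ ![0, 1]
      + (ε : ℂ) • coef a b c ψ ![0, 2]) q = cderiv (Zbar a b c j) (coef a b c ψ ![0, 1]) q
        + ε * cderiv (Zbar a b c j) (coef a b c ψ ![0, 2]) q := fun j q => by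
    rw [cderiv_add (hdiff _ q) ((hdiff _ q).const_smul _), cderiv_smul (hdiff _ q)]
  refine eq_mul_wave_of_cderiv_Zbar (b := b) ha hc
    ((hdiff ![0, 1]).add ((hdiff ![0, 2]).const_smul (ε : ℂ))) bounded
    (fun q => ?_) (fun j hj q => ?_) x
  · rw [cderiv_eq, (system q).1, (system q).2.1]
    simp only [Matrix.cons_val_zero, Complex.ofReal_mul, Complex.ofReal_div, Complex.ofReal_ofNat,
      Complex.coe_smul, Pi.add_apply, Pi.smul_apply, Complex.real_smul]
    linear_combination (-c / 4 * coef a b c ψ ![0, 2] q) * hε'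
  · rw [cderiv_eq, (system q).1, (system q).2.1, hzero q]
    fin_cases j <;> simp_all

theorem eq_zero_of_coef_zero_eq_zero_two (ha : a ≠ 0) (hc : c ≠ 0) (hψ : ψ ∈ harmonic D a b c 2 0)
    (h : ∀ ε : ℝ, ε ^ 2 = 1 → coef a b c ψ ![0, 1] 0 + ε * coef a b c ψ ![0, 2] 0 = 0) : ψ = 0 := by
  have combination_eq_zero : ∀ ε : ℝ, ε ^ 2 = 1 → ∀ x,
      coef a b c ψ ![0, 1] x + ε * coef a b c ψ ![0, 2] x = 0 := fun ε hε x => by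
    rw [coef_add_smul_coef_eq_mul_wave ha hc hψ hε, h ε hε, zero_mul]
  have sum_eq_zero := combination_eq_zero 1 (by norm_num)
  have difference_eq_zero := combination_eq_zero (-1) (by norm_num)
  push_cast at sum_eq_zero difference_eq_zero
  refine eq_zero_of_mem_harmonic ha hc hψ (forall_strictMono_two.mpr
    ⟨fun x => ?_, fun x => ?_, coef_one_two_eq_zero_of_mem_harmonic_two ha hc hψ⟩)
  · linear_combination (sum_eq_zero x + difference_eq_zero x) / 2
  · linear_combination (sum_eq_zero x - difference_eq_zero x) / 2

theorem exists_eq_four_pi_mul_of_isLatticeInvariant_wave (D : LatticeData) {ε : ℝ}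
    (hε : ε ^ 2 = 1) (h : IsLatticeInvariant D (wave (ε * (c / 2)))) :
    ∃ m : ℤ, c = 4 * Real.pi * m := by
  obtain ⟨n, hn⟩ := (isLatticeInvariant_wave_iff D _).mp h
  obtain rfl | rfl := sq_eq_one_iff.mp hε
  · exact ⟨n, by linarith⟩
  · exact ⟨-n, by push_cast; linarith⟩

theorem hodgeNumber_two_of_not_exists (D : LatticeData) (ha : a ≠ 0) (b : ℝ) (hc : c ≠ 0)
    (hm : ¬ ∃ m : ℤ, c = 4 * Real.pi * m) : hodgeNumber D a b c 2 0 = 0 := by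
  rw [← Nat.cast_zero]
  refine hodgeNumber_eq (K := Fin.elim0) (fun ψ hψ _ => ?_) fun r =>
    ⟨0, zero_mem (harmonic D a b c 2 0), fun i => i.elim0⟩
  refine eq_zero_of_coef_zero_eq_zero_two ha hc hψ fun ε hε => ?_
  by_contra hne
  refine hm (exists_eq_four_pi_mul_of_isLatticeInvariant_wave D hε fun γ hγ x => ?_)
  apply mul_left_cancel₀ hne
  rw [← coef_add_smul_coef_eq_mul_wave ha hc hψ hε, ← coef_add_smul_coef_eq_mul_wave ha hc hψ hε,
    isLatticeInvariant_coef (p := 2) hψ.1 _ γ hγ, isLatticeInvariant_coef (p := 2) hψ.1 _ γ hγ]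

/-- The forms `(u e^{-icx/2} + v e^{icx/2}) θ₁ ∧ θ₂ + (u e^{-icx/2} - v e^{icx/2}) θ₁ ∧ θ₃`, which
are the solutions of `∂̄ψ = 0` on the universal cover with bounded coefficients. -/
def waveForm (a b c : ℝ) (u v : ℂ) : Form 2 :=
  monomialForm a b c (u • wave (c / 2) + v • wave (-(c / 2))) ![0, 1]
    + monomialForm a b c (u • wave (c / 2) - v • wave (-(c / 2))) ![0, 2]

theorem coef_waveForm (ha : a ≠ 0) (b : ℝ) (hc : c ≠ 0) (u v : ℂ) :
    coef a b c (waveForm a b c u v) ![0, 1] = u • wave (c / 2) + v • wave (-(c / 2)) ∧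
    coef a b c (waveForm a b c u v) ![0, 2] = u • wave (c / 2) - v • wave (-(c / 2)) ∧
    coef a b c (waveForm a b c u v) ![1, 2] = fun _ => 0 := by
  have coef_eq : ∀ K x, coef a b c (waveForm a b c u v) K x
      = coef a b c (monomialForm a b c (u • wave (c / 2) + v • wave (-(c / 2))) ![0, 1]) K x
      + coef a b c (monomialForm a b c (u • wave (c / 2) - v • wave (-(c / 2))) ![0, 2]) K x :=
    fun K x => by
      simp only [coef, waveForm, Pi.add_apply, map_add, AlternatingMap.add_apply]
  refine ⟨?_, ?_, ?_⟩ <;> funext x <;>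
    rw [coef_eq, coef_monomialForm ha hc, coef_monomialForm ha hc, Matrix.det_fin_two,
      Matrix.det_fin_two] <;>
    simp

theorem waveForm_mem_forms (D : LatticeData) (ha : a ≠ 0) (b : ℝ) (hc : c ≠ 0)
    (hm : ∃ m : ℤ, c = 4 * Real.pi * m) (u v : ℂ) : waveForm a b c u v ∈ forms D a b c 2 0 := by
  obtain ⟨m, hm⟩ := hm
  have invariant_pos : IsLatticeInvariant D (wave (c / 2)) :=
    (isLatticeInvariant_wave_iff D _).mpr ⟨m, by linarith⟩
  have invariant_neg : IsLatticeInvariant D (wave (-(c / 2))) :=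
    (isLatticeInvariant_wave_iff D _).mpr ⟨-m, by push_cast; linarith⟩
  have smooth_pos : ContDiff ℝ ∞ (u • wave (c / 2)) := contDiff_const.smul (contDiff_wave _)
  have smooth_neg : ContDiff ℝ ∞ (v • wave (-(c / 2))) := contDiff_const.smul (contDiff_wave _)
  refine add_mem (monomialForm_mem_forms (p := 2) ha hc (smooth_pos.add smooth_neg)
    (fun γ hγ x => ?_) _) (monomialForm_mem_forms (p := 2) ha hc (smooth_pos.sub smooth_neg)
      (fun γ hγ x => ?_) _) <;>
    simp [invariant_pos γ hγ x, invariant_neg γ hγ x]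

theorem cderiv_Zbar_wave_add (a b c : ℝ) (u v : ℂ) (j : Fin 3) (x : E) :
    cderiv (Zbar a b c j) (u • wave (c / 2) + v • wave (-(c / 2))) x
      = if j = 0 then c / 4 * (u • wave (c / 2) - v • wave (-(c / 2))) x else 0 := by
  have hdiff : ∀ r, Differentiable ℝ (wave r) := fun r =>
    (contDiff_wave r).differentiable (by simp)
  rw [cderiv_add ((hdiff _ x).const_smul u) ((hdiff _ x).const_smul v), cderiv_smul (hdiff _ x),
    cderiv_smul (hdiff _ x), cderiv_Zbar_wave, cderiv_Zbar_wave]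
  split_ifs
  · simp only [Pi.sub_apply, Pi.smul_apply, smul_eq_mul, Complex.ofReal_neg]
    push_cast
    ring
  · rw [mul_zero, mul_zero, add_zero]

theorem waveForm_mem_harmonic (D : LatticeData) (ha : a ≠ 0) (b : ℝ) (hc : c ≠ 0)
    (hm : ∃ m : ℤ, c = 4 * Real.pi * m) (u v : ℂ) : waveForm a b c u v ∈ harmonic D a b c 2 0 := by
  obtain ⟨coef01, coef02, coef12⟩ := coef_waveForm ha b hc u v
  have neg_smul_eq : u • wave (c / 2) - v • wave (-(c / 2))
      = u • wave (c / 2) + (-v) • wave (-(c / 2)) := by rw [neg_smul, sub_eq_add_neg]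
  refine (mem_harmonic_two_iff ha hc).mpr ⟨waveForm_mem_forms D ha b hc hm u v, fun x => ?_⟩
  rw [coef01, coef02, coef12]
  refine ⟨fun j => ?_, fun j => ?_, fun j => cderiv_const _ _ _⟩
  · rw [cderiv_Zbar_wave_add]
    fin_cases j <;> simp
  · rw [neg_smul_eq, cderiv_Zbar_wave_add]
    fin_cases j <;> simp

theorem hodgeNumber_two_of_exists (D : LatticeData) (ha : a ≠ 0) (b : ℝ) (hc : c ≠ 0)
    (hm : ∃ m : ℤ, c = 4 * Real.pi * m) : hodgeNumber D a b c 2 0 = 2 := by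
  rw [← Nat.cast_ofNat]
  refine hodgeNumber_eq (K := ![![0, 1], ![0, 2]]) (fun ψ hψ hzero => ?_) fun r => ?_
  · refine eq_zero_of_coef_zero_eq_zero_two ha hc hψ fun ε _ => ?_
    have first : coef a b c ψ ![0, 1] 0 = 0 := hzero 0
    have second : coef a b c ψ ![0, 2] 0 = 0 := hzero 1
    rw [first, second, mul_zero, add_zero]
  · obtain ⟨coef01, coef02, -⟩ := coef_waveForm ha b hc ((r 0 + r 1) / 2) ((r 0 - r 1) / 2)
    have wave_zero : ∀ s, wave s 0 = 1 := fun s => by simp [wave]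
    refine ⟨_, waveForm_mem_harmonic D ha b hc hm ((r 0 + r 1) / 2) ((r 0 - r 1) / 2),
      Fin.forall_fin_two.mpr ⟨(congrFun coef01 0).trans ?_, (congrFun coef02 0).trans ?_⟩⟩
    · simp only [Pi.add_apply, Pi.smul_apply, wave_zero, smul_eq_mul]
      ring
    · simp only [Pi.sub_apply, Pi.smul_apply, wave_zero, smul_eq_mul]
      ring

end TwoForms

end HodgeNumbers

end Solvmanifold

end

theorem mainTheorem3 (D : Solvmanifold.LatticeData) (a b c : ℝ) (ha : a ≠ 0) (hc : c ≠ 0) :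
    Solvmanifold.hodgeNumber D a b c 1 0 = 1 ∧
    ((¬ ∃ m : ℤ, c = 4 * Real.pi * m) → Solvmanifold.hodgeNumber D a b c 2 0 = 0) ∧
    ((∃ m : ℤ, c = 4 * Real.pi * m) → Solvmanifold.hodgeNumber D a b c 2 0 = 2) ∧
    Solvmanifold.hodgeNumber D a b c 3 0 = 1 :=
  ⟨Solvmanifold.hodgeNumber_one D ha b hc, Solvmanifold.hodgeNumber_two_of_not_exists D ha b hc,
    Solvmanifold.hodgeNumber_two_of_exists D ha b hc, Solvmanifold.hodgeNumber_three D ha b hc⟩
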